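/- Let $m,n,p$ be natural numbers, let $X$ be a fixed $m\times p$ real matrix of rank $q$, let $A$ be a fixed $p\times n$ real matrix of rank $r$, and let $Y=XA+E$, where the entries of the random $m\times n$ matrix $E$ are independent with distribution $N(0,\sigma^2)$, $\sigma\ge 0$. For a matrix $B$ write $d_1(B)\ge d_2(B)\ge\cdots$ for its singular values, $\|B\|_F$ for its Frobenius norm and $\|B\|_1=\sum_j d_j(B)$ for its nuclear norm. Let $M=X'X$, with eigenvalues $\lambda_1(M)\ge\cdots\ge\lambda_p(M)$; assume $p\ge 1$ and $\lambda_p(M)>0$, and let $c_0(M)=\lambda_1(M)/\lambda_p(M)$. Let $\theta>0$ and $$\tau=(1+\theta)\,d_1(X)\,\sigma(\sqrt n+\sqrt q),$$ and let $\tilde A$ be the minimizer of $\|Y-XB\|_F^2+2\tau\|B\|_1$ over all $p\times n$ matrices $B$. Then there is a constant $C>0$ depending only on $\theta$ such that, with probability at least $1-\exp(-\theta^2(n+q)/2)$, both of the following hold: $$\|X\tilde A-XA\|_F^2\le C\min_{0\le k\le r}\Big(\sum_{j=k+1}^r d_j^2(XA)+c_0(M)\,k\,\sigma^2(n+q)\Big),$$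 and, for every $0\le k\le r$, $$\|\tilde A-A\|_F^2\le C\Big(c_0(M)\sum_{j=k+1}^r d_j^2(A)+\frac{c_0(M)}{\lambda_p(M)}\,k\,\sigma^2(n+q)\Big).$$ -/

import Mathlib

open MeasureTheory ProbabilityTheory
open scoped NNReal Matrix

namespace NNP

/-- `sv B j` is the `j`-th largest singular value `d_j(B)` of `B`, for `j ≥ 1` (Mathlib counts
singular values from `0`). It is `0` when `j` exceeds the rank of `B`. -/
noncomputable def sv {a b : ℕ} (B : Matrix (Fin a) (Fin b) ℝ) (j : ℕ) : ℝ :=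
  (Matrix.toEuclideanLin B).singularValues (j - 1)

/-- The nuclear norm `‖B‖₁`, the sum of all singular values of `B`. -/
noncomputable def nuclearNorm {a b : ℕ} (B : Matrix (Fin a) (Fin b) ℝ) : ℝ :=
  ∑ j ∈ Finset.Icc 1 (min a b), sv B j

/-- The squared Frobenius norm `‖B‖_F²`. -/
def frobSq {a b : ℕ} (B : Matrix (Fin a) (Fin b) ℝ) : ℝ :=
  ∑ i, ∑ j, B i j ^ 2

open Classical in
/-- `eig M j` is the `j`-th largest eigenvalue `λ_j(M)` of the symmetric matrix `M`, counted with
multiplicity, for `1 ≤ j ≤ p`; the value is `0` otherwise. -/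
noncomputable def eig {p : ℕ} (M : Matrix (Fin p) (Fin p) ℝ) (j : ℕ) : ℝ :=
  if h : M.IsHermitian ∧ 1 ≤ j ∧ j ≤ p then
    h.1.eigenvalues₀ ⟨j - 1, by rw [Fintype.card_fin]; omega⟩
  else 0

/-- The condition number `c₀(M) = λ₁(M) / λ_p(M)`. -/
noncomputable def condNumber {p : ℕ} (M : Matrix (Fin p) (Fin p) ℝ) : ℝ :=
  eig M 1 / eig M p

/-- `B` is a nuclear norm penalized least squares estimator: it minimizes
`‖Y - X B‖_F² + 2 τ ‖B‖₁` over all `p × n` matrices. -/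
def IsNNPEstimator {m n p : ℕ} (X : Matrix (Fin m) (Fin p) ℝ) (Y : Matrix (Fin m) (Fin n) ℝ)
    (τ : ℝ) (B : Matrix (Fin p) (Fin n) ℝ) : Prop :=
  ∀ B' : Matrix (Fin p) (Fin n) ℝ,
    frobSq (Y - X * B) + 2 * τ * nuclearNorm B ≤ frobSq (Y - X * B') + 2 * τ * nuclearNorm B'

/-- The entries of the random matrix `E` are independent with law `N(0, σ²)`. -/
def IsGaussianNoise {m n : ℕ} {Ω : Type*} [MeasurableSpace Ω] (P : Measure Ω) (σ : ℝ≥0)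
    (E : Ω → Matrix (Fin m) (Fin n) ℝ) : Prop :=
  (∀ i j, HasLaw (fun ω => E ω i j) (gaussianReal 0 (σ ^ 2)) P) ∧
    iIndepFun (fun (ij : Fin m × Fin n) ω => E ω ij.1 ij.2) P

end NNP

/-! The argument has a deterministic half, valid whenever `XᵀE` has operator norm at most `τ`, and a
probabilistic half bounding the probability that this fails.

Deterministic half: compare the minimizer `Â` with a matrix `B` of rank at most `k`. The noise term
`⟨XᵀE, Â - B⟩` and the penalty difference `τ(‖B‖₁ - ‖Â‖₁)` are handled together. Take `K` to be `τ`
times a subgradient of the nuclear norm at `B`, chosen to agree with `XᵀE` off the row and column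
spaces of `B`; then `XᵀE - K` has Frobenius norm `O(τ√k)` (`frobInner_add_nuclearNorm_sub_le`). As
`d_p(X) > 0`, `‖Â - B‖_F` is controlled by prediction errors, and a quadratic inequality gives
`IsNNPEstimator.prediction_error_le`. Both bounds follow with `B = AQ`, where `Q` projects on
leading right singular vectors of `XA` or of `A` (`exists_truncation`).

Probabilistic half: `‖XᵀE‖` is at most `d₁(X)` times the norm of `E` projected on the column space
of `X`, of dimension `q`. For that norm Chevet's inequality is proved at the level of Laplace
transforms. The process `uᵀWv` plus an independent scalar Gaussian is compared with `⟨g,u⟩ + ⟨h,v⟩`: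
variances agree, and the covariances differ by `(1 - u·u')(1 - v·v') ≥ 0`. The comparison
(`integral_expSum_rpow_le`) concerns `(∑ exp(β Xᵢ))^α`, which for `β = l/α` tends to `exp(l max Xᵢ)`
as `α → 0`. The second process is bounded by two Gaussian norms, whose Laplace transforms come from
Stein's identity (`integral_exp_norm_proj_le`). The scalar Gaussian cancels one factor `exp(l²/2)`,
leaving the tail `exp(-T²/2)` beyond `√q + √n + T`; `T = θ(√n + √q)` yields
`measureReal_noise_bound`. -/

namespace NNP

open Matrix

/-- The Frobenius inner product of two matrices. -/
def frobInner {a b : ℕ} (B D : Matrix (Fin a) (Fin b) ℝ) : ℝ := ∑ i, ∑ j, B i j * D i j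

/-! ### Frobenius geometry. -/

section Frobenius

variable {a b : ℕ}

lemma frobSq_eq_frobInner (B : Matrix (Fin a) (Fin b) ℝ) : frobSq B = frobInner B B := by
  simp [frobSq, frobInner, sq]

lemma frobSq_nonneg (B : Matrix (Fin a) (Fin b) ℝ) : 0 ≤ frobSq B :=
  Finset.sum_nonneg fun _ _ => Finset.sum_nonneg fun _ _ => sq_nonneg _

lemma frobInner_comm (B D : Matrix (Fin a) (Fin b) ℝ) : frobInner B D = frobInner D B := by
  simp [frobInner, mul_comm]

lemma frobInner_sub_left (B C D : Matrix (Fin a) (Fin b) ℝ) :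
    frobInner (B - C) D = frobInner B D - frobInner C D := by
  simp [frobInner, sub_mul]

lemma frobInner_sub_right (B C D : Matrix (Fin a) (Fin b) ℝ) :
    frobInner D (B - C) = frobInner D B - frobInner D C := by
  simp [frobInner, mul_sub]

lemma frobInner_eq_trace (B D : Matrix (Fin a) (Fin b) ℝ) :
    frobInner B D = (Bᵀ * D).trace := by
  simp only [frobInner, trace, diag, mul_apply, transpose_apply]
  exact Finset.sum_comm

lemma frobInner_mul_right {c : ℕ} (B : Matrix (Fin a) (Fin b) ℝ) (X : Matrix (Fin a) (Fin c) ℝ)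
    (D : Matrix (Fin c) (Fin b) ℝ) : frobInner B (X * D) = frobInner (Xᵀ * B) D := by
  simp [frobInner_eq_trace, transpose_mul, Matrix.mul_assoc]

lemma frobSq_sub (B D : Matrix (Fin a) (Fin b) ℝ) :
    frobSq (B - D) = frobSq B - 2 * frobInner B D + frobSq D := by
  simp only [frobSq_eq_frobInner, frobInner_sub_left, frobInner_sub_right, frobInner_comm D B]
  ring

lemma frobSq_sub_comm (B D : Matrix (Fin a) (Fin b) ℝ) : frobSq (B - D) = frobSq (D - B) := by
  rw [frobSq_sub, frobSq_sub, frobInner_comm]; ring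

lemma frobInner_le_sqrt_mul_sqrt (B D : Matrix (Fin a) (Fin b) ℝ) :
    frobInner B D ≤ √(frobSq B) * √(frobSq D) := by
  have := Real.sum_mul_le_sqrt_mul_sqrt Finset.univ
    (fun ij : Fin a × Fin b => B ij.1 ij.2) (fun ij => D ij.1 ij.2)
  simpa [frobInner, frobSq, Fintype.sum_prod_type] using this

lemma sqrt_frobSq_sub_le (B C D : Matrix (Fin a) (Fin b) ℝ) :
    √(frobSq (B - D)) ≤ √(frobSq (B - C)) + √(frobSq (D - C)) := by
  have h := frobSq_sub (B - C) (D - C)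
  rw [sub_sub_sub_cancel_right] at h
  have h2 := frobInner_le_sqrt_mul_sqrt (C - B) (D - C)
  have h3 : frobInner (C - B) (D - C) = - frobInner (B - C) (D - C) := by
    simp only [frobInner_sub_left]; ring
  rw [frobSq_sub_comm C B, h3] at h2
  apply Real.sqrt_le_iff.2 ⟨by positivity, ?_⟩
  rw [h, add_sq, Real.sq_sqrt (frobSq_nonneg _), Real.sq_sqrt (frobSq_nonneg _)]
  linarith

/-- Parseval's identity, applied to each pair of rows. It allows Frobenius quantities to be computed
in a right singular basis. -/
lemma frobInner_eq_sum_inner {ι : Type*} [Fintype ι] (B D : Matrix (Fin a) (Fin b) ℝ)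
    (v : OrthonormalBasis ι ℝ (EuclideanSpace ℝ (Fin b))) :
    frobInner B D = ∑ i, inner ℝ (toEuclideanLin B (v i)) (toEuclideanLin D (v i)) := by
  have h : ∀ (C : Matrix (Fin a) (Fin b) ℝ) (x : EuclideanSpace ℝ (Fin b)) (r : Fin a),
      toEuclideanLin C x r = inner ℝ (WithLp.toLp 2 (C r)) x := by
    intro C x r
    simp [toLpLin_apply, mulVec, dotProduct, PiLp.inner_apply, mul_comm]
  have h2 : ∀ i, inner ℝ (toEuclideanLin B (v i)) (toEuclideanLin D (v i)) =
      ∑ r, inner ℝ (WithLp.toLp 2 (B r)) (v i) * inner ℝ (v i) (WithLp.toLp 2 (D r)) := by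
    intro i
    rw [PiLp.inner_apply]
    refine Finset.sum_congr rfl fun r _ => ?_
    rw [h, h, real_inner_comm (WithLp.toLp 2 (D r)) (v i)]
    simp [mul_comm]
  simp_rw [h2]
  rw [Finset.sum_comm]
  simp_rw [OrthonormalBasis.sum_inner_mul_inner]
  simp [frobInner, PiLp.inner_apply, mul_comm]

lemma frobSq_eq_sum_norm_sq {ι : Type*} [Fintype ι] (B : Matrix (Fin a) (Fin b) ℝ)
    (v : OrthonormalBasis ι ℝ (EuclideanSpace ℝ (Fin b))) :
    frobSq B = ∑ i, ‖toEuclideanLin B (v i)‖ ^ 2 := by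
  rw [frobSq_eq_frobInner, frobInner_eq_sum_inner B B v]
  simp

end Frobenius

/-! ### Singular values, conditioning and low rank truncation. -/

section SingularValues

variable {a b : ℕ}

lemma toEuclideanLin_mul {c : ℕ} (B : Matrix (Fin a) (Fin b) ℝ) (D : Matrix (Fin b) (Fin c) ℝ)
    (x : EuclideanSpace ℝ (Fin c)) :
    toEuclideanLin (B * D) x = toEuclideanLin B (toEuclideanLin D x) := by
  simp [toLpLin_apply]

lemma inner_toEuclideanLin_left (B : Matrix (Fin a) (Fin b) ℝ) (x : EuclideanSpace ℝ (Fin b))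
    (y : EuclideanSpace ℝ (Fin a)) :
    inner ℝ (toEuclideanLin B x) y = inner ℝ x (toEuclideanLin Bᵀ y) := by
  rw [← conjTranspose_eq_transpose_of_trivial, toEuclideanLin_conjTranspose_eq_adjoint,
    LinearMap.adjoint_inner_right]

lemma rank_eq_finrank_range_toEuclideanLin (B : Matrix (Fin a) (Fin b) ℝ) :
    B.rank = Module.finrank ℝ (LinearMap.range (toEuclideanLin B)) := by
  rw [toEuclideanLin_eq_toLin_orthonormal]
  exact rank_eq_finrank_range_toLin _ _ _

lemma sv_nonneg (B : Matrix (Fin a) (Fin b) ℝ) (j : ℕ) : 0 ≤ sv B j :=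
  LinearMap.singularValues_nonneg _ _

lemma sv_eq_zero_iff {B : Matrix (Fin a) (Fin b) ℝ} {i : ℕ} : sv B (i + 1) = 0 ↔ B.rank ≤ i := by
  rw [sv, add_tsub_cancel_right, LinearMap.singularValues_eq_zero_iff_le_finrank_range,
    rank_eq_finrank_range_toEuclideanLin]

/-- A right singular basis of a matrix. -/
lemma exists_right_singular_basis (B : Matrix (Fin a) (Fin b) ℝ) :
    ∃ v : OrthonormalBasis (Fin b) ℝ (EuclideanSpace ℝ (Fin b)), ∀ i j,
      inner ℝ (toEuclideanLin B (v i)) (toEuclideanLin B (v j)) =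
        if i = j then sv B (i + 1) ^ 2 else 0 := by
  set T := toEuclideanLin B
  have hn : Module.finrank ℝ (EuclideanSpace ℝ (Fin b)) = b := finrank_euclideanSpace_fin
  refine ⟨T.isSymmetric_adjoint_comp_self.eigenvectorBasis hn, fun i j => ?_⟩
  rw [← LinearMap.adjoint_inner_right, ← LinearMap.comp_apply,
    LinearMap.IsSymmetric.apply_eigenvectorBasis, inner_smul_right, orthonormal_iff_ite.1
    (OrthonormalBasis.orthonormal _), sv, add_tsub_cancel_right, ← LinearMap.sq_singularValues_fin]
  split_ifs with h <;> simp [h, T]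

lemma norm_apply_right_singular_basis {B : Matrix (Fin a) (Fin b) ℝ}
    {v : OrthonormalBasis (Fin b) ℝ (EuclideanSpace ℝ (Fin b))}
    (hv : ∀ i j, inner ℝ (toEuclideanLin B (v i)) (toEuclideanLin B (v j)) =
        if i = j then sv B (i + 1) ^ 2 else 0) (i : Fin b) :
    ‖toEuclideanLin B (v i)‖ = sv B (i + 1) := by
  have := hv i i
  rw [if_pos rfl, real_inner_self_eq_norm_sq] at this
  exact (sq_eq_sq₀ (norm_nonneg _) (sv_nonneg _ _)).1 this

lemma norm_sq_apply_eq_sum {B : Matrix (Fin a) (Fin b) ℝ}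
    {v : OrthonormalBasis (Fin b) ℝ (EuclideanSpace ℝ (Fin b))}
    (hv : ∀ i j, inner ℝ (toEuclideanLin B (v i)) (toEuclideanLin B (v j)) =
        if i = j then sv B (i + 1) ^ 2 else 0) (x : EuclideanSpace ℝ (Fin b)) :
    ‖toEuclideanLin B x‖ ^ 2 = ∑ i : Fin b, sv B (i + 1) ^ 2 * inner ℝ (v i) x ^ 2 := by
  have hx : toEuclideanLin B x = ∑ i, inner ℝ (v i) x • toEuclideanLin B (v i) := by
    conv_lhs => rw [← v.sum_repr' x]
    simp
  rw [hx, ← real_inner_self_eq_norm_sq, sum_inner]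
  simp_rw [inner_sum, inner_smul_left, inner_smul_right, hv]
  refine Finset.sum_congr rfl fun i _ => ?_
  simp
  ring

/-- The terms beyond `min a b` vanish by the rank bound, so the sum can be indexed like a right
singular basis. -/
lemma nuclearNorm_eq_sum (B : Matrix (Fin a) (Fin b) ℝ) :
    nuclearNorm B = ∑ i : Fin b, sv B (i + 1) := by
  have h1 : nuclearNorm B = ∑ j ∈ Finset.range (min a b), sv B (j + 1) := by
    rw [nuclearNorm, Finset.range_eq_Ico, Finset.sum_Ico_add' (sv B) 0 (min a b) 1]
    rfl
  rw [h1, Fin.sum_univ_eq_sum_range (fun i => sv B (i + 1))]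
  refine Finset.sum_subset (Finset.range_subset_range.2 (min_le_right _ _)) fun i _ hi => ?_
  rw [sv_eq_zero_iff]
  have := B.rank_le_height
  have := B.rank_le_width
  rw [Finset.mem_range] at hi
  omega

lemma norm_sq_apply_le (B : Matrix (Fin a) (Fin b) ℝ) (x : EuclideanSpace ℝ (Fin b)) :
    ‖toEuclideanLin B x‖ ^ 2 ≤ sv B 1 ^ 2 * ‖x‖ ^ 2 := by
  obtain ⟨v, hv⟩ := exists_right_singular_basis B
  rw [norm_sq_apply_eq_sum hv, ← v.sum_sq_norm_inner_right x, Finset.mul_sum]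
  refine Finset.sum_le_sum fun i _ => ?_
  rw [Real.norm_eq_abs, sq_abs]
  refine mul_le_mul_of_nonneg_right ?_ (sq_nonneg _)
  exact pow_le_pow_left₀ (sv_nonneg _ _) (LinearMap.singularValues_antitone _ (by simp)) 2

lemma le_norm_sq_apply (B : Matrix (Fin a) (Fin b) ℝ) (x : EuclideanSpace ℝ (Fin b)) :
    sv B b ^ 2 * ‖x‖ ^ 2 ≤ ‖toEuclideanLin B x‖ ^ 2 := by
  obtain ⟨v, hv⟩ := exists_right_singular_basis B
  rw [norm_sq_apply_eq_sum hv, ← v.sum_sq_norm_inner_right x, Finset.mul_sum]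
  refine Finset.sum_le_sum fun i _ => ?_
  rw [Real.norm_eq_abs, sq_abs]
  refine mul_le_mul_of_nonneg_right ?_ (sq_nonneg _)
  exact pow_le_pow_left₀ (sv_nonneg _ _) (LinearMap.singularValues_antitone _ (by simp; omega)) 2

lemma frobSq_mul_le {c : ℕ} (X : Matrix (Fin a) (Fin b) ℝ) (B : Matrix (Fin b) (Fin c) ℝ) :
    frobSq (X * B) ≤ sv X 1 ^ 2 * frobSq B := by
  have v := EuclideanSpace.basisFun (Fin c) ℝ
  rw [frobSq_eq_sum_norm_sq _ v, frobSq_eq_sum_norm_sq _ v, Finset.mul_sum]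
  refine Finset.sum_le_sum fun i _ => ?_
  rw [toEuclideanLin_mul]
  exact norm_sq_apply_le _ _

lemma le_frobSq_mul {c : ℕ} (X : Matrix (Fin a) (Fin b) ℝ) (B : Matrix (Fin b) (Fin c) ℝ) :
    sv X b ^ 2 * frobSq B ≤ frobSq (X * B) := by
  have v := EuclideanSpace.basisFun (Fin c) ℝ
  rw [frobSq_eq_sum_norm_sq _ v, frobSq_eq_sum_norm_sq _ v, Finset.mul_sum]
  refine Finset.sum_le_sum fun i _ => ?_
  rw [toEuclideanLin_mul]
  exact le_norm_sq_apply _ _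

lemma eig_transpose_mul_self (X : Matrix (Fin a) (Fin b) ℝ) {j : ℕ} (hj : 1 ≤ j) (hjb : j ≤ b) :
    eig (Xᵀ * X) j = sv X j ^ 2 := by
  have hH : (Xᵀ * X).IsHermitian := by
    simpa using isHermitian_conjTranspose_mul_self X
  rw [eig, dif_pos ⟨hH, hj, hjb⟩, sv]
  have hn : Module.finrank ℝ (EuclideanSpace ℝ (Fin b)) = Fintype.card (Fin b) := by simp
  rw [LinearMap.sq_singularValues_of_lt _ hn (i := j - 1) (by simp; omega)]
  -- The eigenvalues carry a proof of symmetry of the operator, so the operator is replaced through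
  -- this transport statement instead of by rewriting.
  have key : ∀ {S T : EuclideanSpace ℝ (Fin b) →ₗ[ℝ] EuclideanSpace ℝ (Fin b)}
      (hS : S.IsSymmetric) (hT : T.IsSymmetric) (_ : S = T) (i : Fin (Fintype.card (Fin b))),
      hS.eigenvalues hn i = hT.eigenvalues hn i := by
    rintro S T hS hT rfl i; rfl
  refine key _ _ ?_ _
  ext x : 1
  rw [← conjTranspose_eq_transpose_of_trivial, toEuclideanLin_mul,
    toEuclideanLin_conjTranspose_eq_adjoint]
  rfl

/-- Projecting on the first `k` right singular vectors gives a matrix of rank at most `k` whose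
distance to the original matrix is the tail of the squared singular values. -/
lemma exists_truncation (B : Matrix (Fin a) (Fin b) ℝ) {k r : ℕ} (hr : B.rank ≤ r) :
    ∃ Q : Matrix (Fin b) (Fin b) ℝ, Q.rank ≤ k ∧
      frobSq (B * Q - B) ≤ ∑ j ∈ Finset.Icc (k + 1) r, sv B j ^ 2 := by
  obtain ⟨v, hv⟩ := exists_right_singular_basis B
  let L : EuclideanSpace ℝ (Fin b) →ₗ[ℝ] EuclideanSpace ℝ (Fin b) :=
    v.toBasis.constr ℝ fun i => if (i : ℕ) < k then v i else 0
  have hL : ∀ i, L (v i) = if (i : ℕ) < k then v i else 0 := by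
    intro i
    have := v.toBasis.constr_basis ℝ (fun i : Fin b => if (i : ℕ) < k then v i else 0) i
    rwa [OrthonormalBasis.coe_toBasis] at this
  obtain ⟨Q, hQ⟩ := (toEuclideanLin (𝕜 := ℝ) (m := Fin b) (n := Fin b)).surjective L
  refine ⟨Q, ?_, ?_⟩
  · rw [rank_eq_finrank_range_toEuclideanLin, hQ, Module.Basis.constr_range]
    have hs : Set.range (fun i : Fin b => if (i : ℕ) < k then v i else 0) ⊆
        insert 0 ((Finset.univ.filter fun i : Fin b => (i : ℕ) < k).image v : Set _) := by
      rintro _ ⟨i, rfl⟩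
      by_cases h : (i : ℕ) < k
      · right; simp only [h, if_true]; exact Finset.mem_coe.2 (Finset.mem_image_of_mem _ (by simpa))
      · left; simp [h]
    refine (Submodule.finrank_mono (Submodule.span_mono hs)).trans ?_
    rw [Submodule.span_insert_zero]
    refine (finrank_span_finset_le_card _).trans (Finset.card_image_le.trans ?_)
    rw [Fin.card_filter_val_lt]
    exact min_le_right _ _
  · rw [frobSq_eq_sum_norm_sq _ v]
    have h1 : ∀ i : Fin b, ‖toEuclideanLin (B * Q - B) (v i)‖ ^ 2 =
        if (i : ℕ) < k then 0 else sv B (i + 1) ^ 2 := by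
      intro i
      rw [map_sub, LinearMap.sub_apply, toEuclideanLin_mul, hQ, hL]
      split_ifs
      · simp
      · simp [norm_apply_right_singular_basis hv]
    simp_rw [h1]
    rw [Fin.sum_univ_eq_sum_range (fun i => if i < k then 0 else sv B (i + 1) ^ 2) b]
    have h2 : ∑ j ∈ Finset.Icc (k + 1) r, sv B j ^ 2 = ∑ i ∈ Finset.Ico k r, sv B (i + 1) ^ 2 := by
      rw [Finset.sum_Ico_add' (fun j => sv B j ^ 2) k r 1]
      rfl
    -- No relation between `b` and `r` is needed: a nonzero term has `k ≤ i < B.rank ≤ r`.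
    rw [h2, ← Finset.sum_filter_ne_zero]
    calc _ ≤ ∑ i ∈ Finset.Ico k r, if i < k then 0 else sv B (i + 1) ^ 2 := by
          refine Finset.sum_le_sum_of_subset_of_nonneg (fun i hi => ?_) fun i _ _ => ?_
          · rw [Finset.mem_filter] at hi
            have h3 : ¬ i < k := fun h => hi.2 (if_pos h)
            have h4 : ¬ B.rank ≤ i := fun h => hi.2 (by rw [if_neg h3, sv_eq_zero_iff.2 h]; simp)
            rw [Finset.mem_Ico]
            omega
          · positivity
      _ = _ := Finset.sum_congr rfl fun i hi => if_neg (by rw [Finset.mem_Ico] at hi; omega)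

end SingularValues

/-! ### Nuclear norm duality and the subgradient argument. -/

section NuclearNorm

variable {a b : ℕ}

/-- Trace duality between nuclear and operator norm: in a right singular basis of `D`, apply
Cauchy–Schwarz to each term. -/
lemma frobInner_le_mul_nuclearNorm (D : Matrix (Fin a) (Fin b) ℝ) {K : Matrix (Fin a) (Fin b) ℝ}
    {τ : ℝ} (hK : ∀ x, ‖toEuclideanLin K x‖ ≤ τ * ‖x‖) :
    frobInner D K ≤ τ * nuclearNorm D := by
  obtain ⟨v, hv⟩ := exists_right_singular_basis D
  rw [frobInner_eq_sum_inner D K v, nuclearNorm_eq_sum, Finset.mul_sum]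
  refine Finset.sum_le_sum fun i _ => (real_inner_le_norm _ _).trans ?_
  rw [norm_apply_right_singular_basis hv, mul_comm]
  have := hK (v i)
  rw [v.norm_eq_one, mul_one] at this
  exact mul_le_mul_of_nonneg_right this (sv_nonneg _ _)

lemma norm_transpose_apply_le {C : Matrix (Fin a) (Fin b) ℝ} {τ : ℝ} (hτ : 0 ≤ τ)
    (hC : ∀ x, ‖toEuclideanLin C x‖ ≤ τ * ‖x‖) (y : EuclideanSpace ℝ (Fin a)) :
    ‖toEuclideanLin Cᵀ y‖ ≤ τ * ‖y‖ := by
  rcases (norm_nonneg (toEuclideanLin Cᵀ y)).eq_or_lt with h | h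
  · rw [← h]
    positivity
  · have h1 := inner_toEuclideanLin_left C (toEuclideanLin Cᵀ y) y
    rw [real_inner_self_eq_norm_sq] at h1
    have h2 := real_inner_le_norm (toEuclideanLin C (toEuclideanLin Cᵀ y)) y
    have h3 := mul_le_mul_of_nonneg_right (hC (toEuclideanLin Cᵀ y)) (norm_nonneg y)
    nlinarith

/-- Moving `C` to the other side of the inner product turns the sum into `∑ ‖Cᵀ wⱼ‖²` over an
orthonormal basis `w` of `U`, with each term at most `τ²`. -/
lemma sum_norm_sq_starProjection_apply_le {C : Matrix (Fin a) (Fin b) ℝ} {τ : ℝ} (hτ : 0 ≤ τ)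
    (hC : ∀ x, ‖toEuclideanLin C x‖ ≤ τ * ‖x‖) (U : Submodule ℝ (EuclideanSpace ℝ (Fin a)))
    (v : OrthonormalBasis (Fin b) ℝ (EuclideanSpace ℝ (Fin b))) :
    ∑ i, ‖U.starProjection (toEuclideanLin C (v i))‖ ^ 2 ≤ Module.finrank ℝ U * τ ^ 2 := by
  have w := stdOrthonormalBasis ℝ U
  have h1 : ∀ i, ‖U.starProjection (toEuclideanLin C (v i))‖ ^ 2 =
      ∑ j, ‖inner ℝ (v i) (toEuclideanLin Cᵀ (w j))‖ ^ 2 := by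
    intro i
    rw [Submodule.starProjection_apply, ← Submodule.coe_norm, ← w.sum_sq_norm_inner_right]
    refine Finset.sum_congr rfl fun j _ => ?_
    rw [Submodule.inner_orthogonalProjectionOnto_eq_of_mem_left, real_inner_comm,
      inner_toEuclideanLin_left]
  simp_rw [h1]
  rw [Finset.sum_comm]
  simp_rw [v.sum_sq_norm_inner_right]
  calc _ ≤ ∑ _j : Fin (Module.finrank ℝ U), τ ^ 2 := Finset.sum_le_sum fun j _ => by
        have := norm_transpose_apply_le hτ hC (w j)
        rw [← Submodule.coe_norm, w.norm_eq_one, mul_one] at this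
        exact pow_le_pow_left₀ (norm_nonneg _) this 2
    _ = _ := by simp

/-- Cone-type inequality for the nuclear norm at a low rank matrix. -/
lemma frobInner_add_nuclearNorm_sub_le {B C : Matrix (Fin a) (Fin b) ℝ}
    (D : Matrix (Fin a) (Fin b) ℝ) {τ : ℝ} {k : ℕ} (hτ : 0 ≤ τ)
    (hC : ∀ x, ‖toEuclideanLin C x‖ ≤ τ * ‖x‖) (hB : B.rank ≤ k) :
    frobInner C (D - B) + τ * (nuclearNorm B - nuclearNorm D) ≤
      3 * (τ * √k) * √(frobSq (D - B)) := by
  obtain ⟨v, hv⟩ := exists_right_singular_basis B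
  set U := LinearMap.range (toEuclideanLin B) with hU
  have hnorm := norm_apply_right_singular_basis hv
  -- The convention `0⁻¹ = 0` kills `y i` beyond the rank, so `B (y i)` is a left singular vector or
  -- zero. Thus `K₀` is `τ` times the partial isometry of `B`, plus the compression of `C` to the
  -- complements of the row and column spaces.
  let y : Fin b → EuclideanSpace ℝ (Fin b) := fun i => (sv B (i + 1))⁻¹ • v i
  let z : Fin b → EuclideanSpace ℝ (Fin b) := fun i => if (i : ℕ) < B.rank then 0 else v i
  let K₀ : EuclideanSpace ℝ (Fin b) →ₗ[ℝ] EuclideanSpace ℝ (Fin a) :=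
    v.toBasis.constr ℝ fun i => τ • toEuclideanLin B (y i) +
      Uᗮ.starProjection (toEuclideanLin C (z i))
  obtain ⟨K, hK⟩ := (toEuclideanLin (𝕜 := ℝ) (m := Fin a) (n := Fin b)).surjective K₀
  have hKv : ∀ i, toEuclideanLin K (v i) = τ • toEuclideanLin B (y i) +
      Uᗮ.starProjection (toEuclideanLin C (z i)) := by
    intro i
    have := v.toBasis.constr_basis ℝ (fun i => τ • toEuclideanLin B (y i) +
      Uᗮ.starProjection (toEuclideanLin C (z i))) i
    rw [OrthonormalBasis.coe_toBasis] at this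
    rw [hK, this]
  have hperp : ∀ x w, inner ℝ (toEuclideanLin B x) (Uᗮ.starProjection w) = 0 := fun x w =>
    (Submodule.mem_orthogonal _ _).1 (Submodule.starProjection_apply_mem _ _) _
      (LinearMap.mem_range_self _ _)
  have hrank : ∀ i : Fin b, (i : ℕ) < B.rank ↔ sv B (i + 1) ≠ 0 := fun i => by
    rw [Ne, sv_eq_zero_iff, not_le]
  have hKnorm : ∀ x, ‖toEuclideanLin K x‖ ≤ τ * ‖x‖ := by
    intro x
    set c : Fin b → ℝ := fun i => inner ℝ (v i) x with hc
    have hx : toEuclideanLin K x = τ • toEuclideanLin B (∑ i, c i • y i) +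
        Uᗮ.starProjection (toEuclideanLin C (∑ i, c i • z i)) := by
      conv_lhs => rw [← v.sum_repr' x]
      simp only [map_sum, map_smul, hKv, smul_add, Finset.sum_add_distrib, Finset.smul_sum]
      congr 1
      exact Finset.sum_congr rfl fun i _ => smul_comm _ _ _
    have h1 : ‖toEuclideanLin B (∑ i, c i • y i)‖ ^ 2 =
        ∑ i : Fin b, if (i : ℕ) < B.rank then c i ^ 2 else 0 := by
      rw [norm_sq_apply_eq_sum hv]
      refine Finset.sum_congr rfl fun i _ => ?_
      have : inner ℝ (v i) (∑ i, c i • y i) = c i * (sv B (i + 1))⁻¹ := by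
        simp [y, inner_sum, inner_smul_right, orthonormal_iff_ite.1 v.orthonormal]
      rw [this]
      split_ifs with h
      · have := (hrank i).1 h
        field_simp
      · have := (hrank i).not_left.1 h
        simp [this]
    have h2 : ‖∑ i, c i • z i‖ ^ 2 = ∑ i : Fin b, if (i : ℕ) < B.rank then 0 else c i ^ 2 := by
      rw [← v.sum_sq_norm_inner_right]
      refine Finset.sum_congr rfl fun i _ => ?_
      have : inner ℝ (v i) (∑ i, c i • z i) = if (i : ℕ) < B.rank then 0 else c i := by
        rw [inner_sum, Finset.sum_eq_single i]
        · simp only [z]; split_ifs <;> simp [inner_smul_right]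
        · intro j _ hj
          simp only [z]
          split_ifs <;> simp [inner_smul_right, orthonormal_iff_ite.1 v.orthonormal, hj.symm]
        · simp
      rw [this]
      split_ifs <;> simp
    -- The two parts of `K x` use disjoint coordinates of `x` and are orthogonal, so each having
    -- norm at most `τ` suffices.
    have h3 : ‖x‖ ^ 2 = ‖toEuclideanLin B (∑ i, c i • y i)‖ ^ 2 + ‖∑ i, c i • z i‖ ^ 2 := by
      rw [h1, h2, ← Finset.sum_add_distrib, ← v.sum_sq_norm_inner_right]
      refine Finset.sum_congr rfl fun i _ => ?_
      split_ifs <;> simp [hc]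
    have h4 : ‖Uᗮ.starProjection (toEuclideanLin C (∑ i, c i • z i))‖ ≤
        τ * ‖∑ i, c i • z i‖ := by
      refine le_trans ?_ (hC _)
      exact Submodule.norm_starProjection_apply_le _ _
    refine le_of_sq_le_sq ?_ (by positivity)
    rw [hx, norm_add_sq_real, inner_smul_left, hperp, norm_smul, mul_pow, mul_pow, h3]
    have := pow_le_pow_left₀ (norm_nonneg _) h4 2
    simp only [Real.norm_eq_abs, sq_abs]
    linarith
  have hBK : frobInner B K = τ * nuclearNorm B := by
    rw [frobInner_eq_sum_inner B K v, nuclearNorm_eq_sum, Finset.mul_sum]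
    refine Finset.sum_congr rfl fun i _ => ?_
    rw [hKv, inner_add_right, hperp, inner_smul_right, map_smul, inner_smul_right, hv, if_pos rfl]
    rcases eq_or_ne (sv B (i + 1)) 0 with h | h
    · simp [h]
    · field_simp; simp
  -- The first `B.rank` basis vectors contribute at most `4τ²` each; on the others `C - K` is the
  -- projection of `C` on `U`, contributing at most `B.rank * τ²` in total. The resulting factor 5
  -- is rounded up to 9.
  have hCK : frobSq (C - K) ≤ (3 * (τ * √k)) ^ 2 := by
    have h1 : ∀ i : Fin b, ‖toEuclideanLin (C - K) (v i)‖ ^ 2 ≤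
        (if (i : ℕ) < B.rank then 4 * τ ^ 2 else 0) +
          ‖U.starProjection (toEuclideanLin C (v i))‖ ^ 2 := by
      intro i
      rw [map_sub, LinearMap.sub_apply, hKv]
      by_cases h : (i : ℕ) < B.rank
      · have h5 := (hrank i).1 h
        have h2 : ‖toEuclideanLin B (y i)‖ = 1 := by
          simp only [y]
          rw [map_smul, norm_smul, hnorm, Real.norm_eq_abs, abs_inv, abs_of_nonneg (sv_nonneg _ _)]
          field_simp
        have h3 : ‖toEuclideanLin C (v i) - τ • toEuclideanLin B (y i)‖ ≤ 2 * τ := by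
          refine (norm_sub_le _ _).trans ?_
          have := hC (v i)
          rw [v.norm_eq_one] at this
          rw [norm_smul, h2, Real.norm_eq_abs, abs_of_nonneg hτ]
          linarith
        have h4 := pow_le_pow_left₀ (norm_nonneg _) h3 2
        simp only [z, h, if_true, map_zero, add_zero]
        nlinarith [sq_nonneg ‖U.starProjection (toEuclideanLin C (v i))‖]
      · have h5 : sv B (i + 1) = 0 := (hrank i).not_left.1 h
        simp only [z, y, h, if_false, h5, _root_.inv_zero, zero_smul, map_zero, smul_zero, zero_add]
        rw [Submodule.starProjection_orthogonal_val, sub_sub_cancel]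
    rw [frobSq_eq_sum_norm_sq _ v]
    refine (Finset.sum_le_sum fun i _ => h1 i).trans ?_
    rw [Finset.sum_add_distrib]
    have h2 := sum_norm_sq_starProjection_apply_le hτ hC U v
    rw [hU, ← rank_eq_finrank_range_toEuclideanLin] at h2
    have h3 : (∑ i : Fin b, if (i : ℕ) < B.rank then 4 * τ ^ 2 else 0) ≤ B.rank * (4 * τ ^ 2) := by
      rw [← Finset.sum_filter, Finset.sum_const, Fin.card_filter_val_lt, nsmul_eq_mul]
      refine mul_le_mul_of_nonneg_right ?_ (by positivity)
      exact_mod_cast min_le_right _ _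
    have h4 : (B.rank : ℝ) ≤ k := by exact_mod_cast hB
    have h6 : √(k : ℝ) ^ 2 = k := Real.sq_sqrt (by positivity)
    have h7 : (3 * (τ * √k)) ^ 2 = 9 * τ ^ 2 * k := by rw [mul_pow, mul_pow, h6]; ring
    rw [h7]
    have h8 := mul_le_mul_of_nonneg_right h4 (sq_nonneg τ)
    have h9 : (0 : ℝ) ≤ k * τ ^ 2 := by positivity
    linarith
  have hDK := frobInner_le_mul_nuclearNorm D hKnorm
  have hfin := frobInner_le_sqrt_mul_sqrt (C - K) (D - B)
  have hs : √(frobSq (C - K)) ≤ 3 * (τ * √k) := Real.sqrt_le_iff.2 ⟨by positivity, hCK⟩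
  have hfin2 := mul_le_mul_of_nonneg_right hs (Real.sqrt_nonneg (frobSq (D - B)))
  have h1 : frobInner (C - K) (D - B) = frobInner C (D - B) - (frobInner D K - frobInner B K) := by
    rw [frobInner_sub_left, frobInner_sub_right D B K, frobInner_comm K, frobInner_comm K]
  rw [hBK] at h1
  linarith

end NuclearNorm

/-- Deterministic oracle inequality for the prediction error of a nuclear norm penalized least
squares estimator. -/
lemma IsNNPEstimator.prediction_error_le {m n p : ℕ} {X : Matrix (Fin m) (Fin p) ℝ}
    {A Ahat : Matrix (Fin p) (Fin n) ℝ} {E : Matrix (Fin m) (Fin n) ℝ} {τ : ℝ}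
    (hmin : IsNNPEstimator X (X * A + E) τ Ahat) (hτ : 0 ≤ τ) (hX : 0 < sv X p)
    (hE : ∀ x, ‖toEuclideanLin (Xᵀ * E) x‖ ≤ τ * ‖x‖) {B : Matrix (Fin p) (Fin n) ℝ} {k : ℕ}
    (hB : B.rank ≤ k) :
    frobSq (X * Ahat - X * A) ≤
      4 * frobSq (X * B - X * A) + 54 * (τ ^ 2 * k / sv X p ^ 2) := by
  have h1 := hmin B
  have h2 : ∀ D : Matrix (Fin p) (Fin n) ℝ, X * A + E - X * D = E - (X * D - X * A) := fun D => by
    abel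
  rw [h2, h2, frobSq_sub E, frobSq_sub E] at h1
  have h3 := frobInner_add_nuclearNorm_sub_le Ahat hτ hE hB
  rw [← frobInner_mul_right, Matrix.mul_sub, frobInner_sub_right] at h3
  simp only [frobInner_sub_right] at h1
  have h4 : sv X p * √(frobSq (Ahat - B)) ≤
      √(frobSq (X * Ahat - X * A)) + √(frobSq (X * B - X * A)) := by
    refine le_trans ?_ (sqrt_frobSq_sub_le _ _ _)
    apply Real.le_sqrt_of_sq_le
    rw [mul_pow, Real.sq_sqrt (frobSq_nonneg _), ← Matrix.mul_sub]
    exact le_frobSq_mul _ _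
  set u := √(frobSq (X * Ahat - X * A)) with hu
  set w := √(frobSq (X * B - X * A)) with hw
  have hu2 : frobSq (X * Ahat - X * A) = u ^ 2 := (Real.sq_sqrt (frobSq_nonneg _)).symm
  have hw2 : frobSq (X * B - X * A) = w ^ 2 := (Real.sq_sqrt (frobSq_nonneg _)).symm
  -- With `u`, `w` the two root prediction errors, everything reduces to `u² ≤ w² + 6s(u + w)`.
  set s := τ * √k / sv X p with hs
  have h5 : τ * √k * √(frobSq (Ahat - B)) ≤ s * (u + w) := by
    have : τ * √k * √(frobSq (Ahat - B)) = s * (sv X p * √(frobSq (Ahat - B))) := by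
      rw [hs]; field_simp
    rw [this]
    exact mul_le_mul_of_nonneg_left h4 (by positivity)
  have h6 : τ ^ 2 * k / sv X p ^ 2 = s ^ 2 := by
    rw [hs, div_pow, mul_pow, Real.sq_sqrt (by positivity)]
  rw [h6, hw2, hu2]
  rw [hw2, hu2] at h1
  -- The squares give `12su ≤ u² + 36s²` and `12sw ≤ 2w² + 18s²`; hence the constants 4 and 54.
  nlinarith [sq_nonneg (u - 6 * s), sq_nonneg (w - 3 * s)]

end NNP

/-! ### Gaussian integrals of functions of exponential growth. -/

namespace NNP

/-- The standard Gaussian measure on `ι → ℝ`. -/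
noncomputable def stdGauss (ι : Type*) [Fintype ι] : Measure (ι → ℝ) :=
  Measure.pi fun _ => gaussianReal 0 1

instance (ι : Type*) [Fintype ι] : IsProbabilityMeasure (stdGauss ι) := by
  unfold stdGauss; infer_instance

/-- Continuous functions of at most exponential growth. -/
def ExpGrowth {ι : Type*} [Fintype ι] (f : (ι → ℝ) → ℝ) : Prop :=
  Continuous f ∧ ∃ c C : ℝ, 0 ≤ c ∧ ∀ W, |f W| ≤ C * Real.exp (c * ∑ k, |W k|)

section Growth

variable {ι : Type*} [Fintype ι]

lemma integrable_exp_mul_abs_gaussianReal (c : ℝ) :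
    Integrable (fun x : ℝ => Real.exp (c * |x|)) (gaussianReal 0 1) :=
  integrable_exp_mul_abs (integrable_exp_mul_gaussianReal c)
    (by simpa using integrable_exp_mul_gaussianReal (-c))

lemma integrable_exp_sum_abs (c : ℝ) :
    Integrable (fun W : ι → ℝ => Real.exp (c * ∑ k, |W k|)) (stdGauss ι) := by
  simp_rw [Finset.mul_sum, Real.exp_sum]
  exact Integrable.fintype_prod (f := fun _ x => Real.exp (c * |x|))
    fun _ => integrable_exp_mul_abs_gaussianReal c

namespace ExpGrowth

variable {f g : (ι → ℝ) → ℝ}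

/-- The class is closed under sums and products and contains the coordinates and exponentials of
linear forms, so integrability of later integrands follows from their shape. -/
lemma integrable (hf : ExpGrowth f) : Integrable f (stdGauss ι) := by
  obtain ⟨hc, c, C, -, h⟩ := hf
  exact ((integrable_exp_sum_abs c).const_mul C).mono' hc.aestronglyMeasurable
    (Filter.Eventually.of_forall h)

lemma mono (hg : ExpGrowth g) (hf : Continuous f) (h : ∀ W, |f W| ≤ g W) : ExpGrowth f := by
  obtain ⟨-, c, C, hc, hC⟩ := hg
  exact ⟨hf, c, C, hc, fun W => (h W).trans ((le_abs_self _).trans (hC W))⟩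

lemma mul (hf : ExpGrowth f) (hg : ExpGrowth g) : ExpGrowth fun W => f W * g W := by
  obtain ⟨hfc, c, C, hc, hC⟩ := hf
  obtain ⟨hgc, c', C', hc', hC'⟩ := hg
  refine ⟨hfc.mul hgc, c + c', C * C', by positivity, fun W => ?_⟩
  rw [abs_mul, add_mul, Real.exp_add, mul_mul_mul_comm]
  exact mul_le_mul (hC W) (hC' W) (abs_nonneg _) ((abs_nonneg _).trans (hC W))

lemma add (hf : ExpGrowth f) (hg : ExpGrowth g) : ExpGrowth fun W => f W + g W := by
  obtain ⟨hfc, c, C, hc, hC⟩ := hf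
  obtain ⟨hgc, c', C', hc', hC'⟩ := hg
  have h0 : 0 ≤ C := by simpa using (abs_nonneg _).trans (hC 0)
  have h0' : 0 ≤ C' := by simpa using (abs_nonneg _).trans (hC' 0)
  refine ⟨hfc.add hgc, c + c', C + C', by positivity, fun W => (abs_add_le _ _).trans ?_⟩
  have hW : 0 ≤ ∑ k, |W k| := Finset.sum_nonneg fun _ _ => abs_nonneg _
  rw [add_mul]
  refine add_le_add ((hC W).trans ?_) ((hC' W).trans ?_) <;> gcongr <;> linarith

lemma const (r : ℝ) : ExpGrowth fun _ : ι → ℝ => r :=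
  ⟨continuous_const, 0, |r|, le_rfl, fun W => by simp⟩

lemma sum {κ : Type*} (s : Finset κ) {F : κ → (ι → ℝ) → ℝ} (h : ∀ i ∈ s, ExpGrowth (F i)) :
    ExpGrowth fun W => ∑ i ∈ s, F i W := by
  classical
  induction s using Finset.induction_on with
  | empty => simpa using const 0
  | insert i s hi ih =>
    simp_rw [Finset.sum_insert hi]
    exact (h i (Finset.mem_insert_self _ _)).add
      (ih fun j hj => h j (Finset.mem_insert_of_mem hj))

lemma sum_abs : ExpGrowth fun W : ι → ℝ => ∑ k, |W k| := by
  refine ⟨by fun_prop, 1, 1, zero_le_one, fun W => ?_⟩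
  rw [abs_of_nonneg (Finset.sum_nonneg fun _ _ => abs_nonneg _), one_mul, one_mul]
  linarith [Real.add_one_le_exp (∑ k, |W k|)]

lemma exp_sum_abs (c : ℝ) : ExpGrowth fun W : ι → ℝ => Real.exp (c * ∑ k, |W k|) := by
  refine ⟨by fun_prop, |c|, 1, abs_nonneg _, fun W => ?_⟩
  rw [abs_of_pos (Real.exp_pos _), one_mul]
  have hW : 0 ≤ ∑ k, |W k| := Finset.sum_nonneg fun _ _ => abs_nonneg _
  gcongr
  exact le_abs_self c

lemma eval (k : ι) : ExpGrowth fun W : ι → ℝ => W k :=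
  sum_abs.mono (by fun_prop) fun W =>
    Finset.single_le_sum (f := fun k => |W k|) (fun _ _ => abs_nonneg _) (Finset.mem_univ k)

end ExpGrowth

lemma abs_dotProduct_le (a W : ι → ℝ) : |a ⬝ᵥ W| ≤ (∑ k, |a k|) * ∑ k, |W k| := by
  rw [dotProduct, Finset.sum_mul]
  refine (Finset.abs_sum_le_sum_abs _ _).trans (Finset.sum_le_sum fun k _ => ?_)
  rw [abs_mul]
  exact mul_le_mul_of_nonneg_left (Finset.single_le_sum (f := fun k => |W k|)
    (fun _ _ => abs_nonneg _) (Finset.mem_univ k)) (abs_nonneg _)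

lemma ExpGrowth.exp_dotProduct (a : ι → ℝ) : ExpGrowth fun W => Real.exp (a ⬝ᵥ W) :=
  (exp_sum_abs (∑ k, |a k|)).mono (by unfold dotProduct; fun_prop) fun W => by
    rw [abs_of_pos (Real.exp_pos _)]
    exact Real.exp_le_exp.2 ((le_abs_self _).trans (abs_dotProduct_le a W))

end Growth

/-! ### Gaussian integration by parts. -/

section IntegrationByParts

lemma hasDerivAt_gaussianPDFReal (x : ℝ) :
    HasDerivAt (gaussianPDFReal 0 1) (-x * gaussianPDFReal 0 1 x) x := by
  have h : HasDerivAt (fun x : ℝ => -(x - 0) ^ 2 / (2 * ((1 : ℝ≥0) : ℝ))) (-x) x := by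
    have := (((hasDerivAt_id x).sub_const 0).pow 2).neg.div_const (2 * ((1 : ℝ≥0) : ℝ))
    refine this.congr_deriv ?_
    simp
    ring
  have := (h.exp).const_mul (√(2 * Real.pi * ((1 : ℝ≥0) : ℝ)))⁻¹
  refine this.congr_deriv ?_
  simp only [gaussianPDFReal]
  ring

/-- Stein's identity for the standard Gaussian on the real line. -/
lemma integral_id_mul_gaussianReal {f f' : ℝ → ℝ} (hf : ∀ x, HasDerivAt f (f' x) x)
    (h0 : Integrable f (gaussianReal 0 1)) (h1 : Integrable f' (gaussianReal 0 1))
    (h2 : Integrable (fun x => x * f x) (gaussianReal 0 1)) :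
    ∫ x, x * f x ∂gaussianReal 0 1 = ∫ x, f' x ∂gaussianReal 0 1 := by
  have key : ∀ {g : ℝ → ℝ}, Integrable g (gaussianReal 0 1) →
      Integrable fun x => gaussianPDFReal 0 1 x * g x := by
    intro g hg
    rw [gaussianReal_of_var_ne_zero _ one_ne_zero, integrable_withDensity_iff_integrable_smul'
      (measurable_gaussianPDF _ _) (by simp [gaussianPDF])] at hg
    refine hg.congr (Filter.Eventually.of_forall fun x => ?_)
    simp [gaussianPDF, ENNReal.toReal_ofReal (gaussianPDFReal_nonneg _ _ _)]
  rw [← sub_eq_zero, ← integral_sub h2 h1, integral_gaussianReal_eq_integral_smul one_ne_zero,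
    ← neg_eq_zero, ← integral_neg]
  -- With `φ` the density, `(φ f)' = -φ (x f - f')`, and the integral of this derivative over the
  -- line vanishes.
  refine integral_eq_zero_of_hasDerivAt_of_integrable (f := fun x => gaussianPDFReal 0 1 x * f x)
    (fun x => ((hasDerivAt_gaussianPDFReal x).mul (hf x)).congr_deriv ?_) ?_ (key h0)
  · simp only [smul_eq_mul]; ring
  · exact (key (h2.sub h1)).neg.congr (Filter.Eventually.of_forall fun x => by simp)

variable {ι : Type*} [Fintype ι] [DecidableEq ι]

/-- Resampling one coordinate independently preserves the product law. This isolates coordinate `k`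
for Fubini without splitting the index type. -/
lemma measurePreserving_update (k : ι) :
    MeasurePreserving (fun p : ℝ × (ι → ℝ) => Function.update p.2 k p.1)
      ((gaussianReal 0 1).prod (stdGauss ι)) (stdGauss ι) := by
  have hm : Measurable fun p : ℝ × (ι → ℝ) => Function.update p.2 k p.1 := by
    rw [measurable_pi_iff]
    intro j
    rcases eq_or_ne j k with rfl | h
    · simpa using measurable_fst
    · simpa [h] using (by fun_prop : Measurable fun p : ℝ × (ι → ℝ) => p.2 j)
  refine ⟨hm, (Measure.pi_eq fun s hs => ?_).symm⟩
  rw [Measure.map_apply hm (MeasurableSet.univ_pi hs)]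
  have : (fun p : ℝ × (ι → ℝ) => Function.update p.2 k p.1) ⁻¹' (Set.univ.pi s) =
      s k ×ˢ Set.univ.pi (Function.update s k Set.univ) := by
    ext p
    simp only [Set.mem_preimage, Set.mem_pi, Set.mem_univ, true_implies, Set.mem_prod]
    constructor
    · intro h
      refine ⟨by simpa using h k, fun j => ?_⟩
      rcases eq_or_ne j k with rfl | hj
      · simp
      · simpa [hj] using h j
    · rintro ⟨h1, h2⟩ j
      rcases eq_or_ne j k with rfl | hj
      · simpa using h1
      · simpa [hj] using h2 j
  rw [this, Measure.prod_prod, stdGauss, Measure.pi_pi,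
    ← Finset.mul_prod_erase _ _ (Finset.mem_univ k), ← Finset.mul_prod_erase Finset.univ
    (fun i => gaussianReal 0 1 (s i)) (Finset.mem_univ k)]
  simp only [Function.update_self, measure_univ, one_mul]
  congr 1
  refine Finset.prod_congr rfl fun j hj => ?_
  rw [Function.update_of_ne (Finset.ne_of_mem_erase hj)]

lemma integral_eval_mul_stdGauss (k : ι) {f f' : (ι → ℝ) → ℝ}
    (hf : ∀ W x, HasDerivAt (fun t => f (Function.update W k t)) (f' (Function.update W k x)) x)
    (h0 : ExpGrowth f) (h1 : ExpGrowth f') :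
    ∫ W, W k * f W ∂stdGauss ι = ∫ W, f' W ∂stdGauss ι := by
  have hmp := measurePreserving_update (ι := ι) k
  have hint : ∀ {g : (ι → ℝ) → ℝ}, ExpGrowth g →
      Integrable (fun p : ℝ × (ι → ℝ) => g (Function.update p.2 k p.1))
        ((gaussianReal 0 1).prod (stdGauss ι)) := fun hg =>
    (hmp.integrable_comp hg.1.aestronglyMeasurable).2 hg.integrable
  have hfub : ∀ {g : (ι → ℝ) → ℝ}, ExpGrowth g → ∫ W, g W ∂stdGauss ι =
      ∫ W, ∫ x, g (Function.update W k x) ∂gaussianReal 0 1 ∂stdGauss ι := by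
    intro g hg
    rw [← integral_prod_symm _ (hint hg), ← hmp.map_eq,
      integral_map hmp.aemeasurable hg.1.aestronglyMeasurable]
    rw [hmp.map_eq]
  have h2 := (ExpGrowth.eval k).mul h0
  rw [hfub h2, hfub h1]
  refine integral_congr_ae ?_
  filter_upwards [(hint h0).prod_left_ae, (hint h1).prod_left_ae, (hint h2).prod_left_ae]
    with W i0 i1 i2
  simp only [Function.update_self] at i2 ⊢
  exact integral_id_mul_gaussianReal (hf W) i0 i1 i2

/-- Gaussian integration by parts in the direction `b`. -/
lemma integral_dotProduct_mul_stdGauss (b : ι → ℝ) {f : (ι → ℝ) → ℝ} {f' : ι → (ι → ℝ) → ℝ}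
    (hf : ∀ k W x, HasDerivAt (fun t => f (Function.update W k t))
      (f' k (Function.update W k x)) x)
    (h0 : ExpGrowth f) (h1 : ∀ k, ExpGrowth (f' k)) :
    ∫ W, (b ⬝ᵥ W) * f W ∂stdGauss ι = ∫ W, ∑ k, b k * f' k W ∂stdGauss ι := by
  simp_rw [dotProduct, Finset.sum_mul, mul_assoc]
  rw [integral_finsetSum _ fun k _ => (((ExpGrowth.eval k).mul h0).integrable.const_mul _),
    integral_finsetSum _ fun k _ => ((h1 k).integrable.const_mul _)]
  refine Finset.sum_congr rfl fun k _ => ?_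
  rw [integral_const_mul, integral_const_mul, integral_eval_mul_stdGauss k (hf k) h0 (h1 k)]

lemma hasDerivAt_dotProduct_update (a W : ι → ℝ) (k : ι) (x : ℝ) :
    HasDerivAt (fun t => a ⬝ᵥ Function.update W k t) (a k) x := by
  have : (fun t => a ⬝ᵥ Function.update W k t) =
      fun t => a k * t + ∑ j ∈ Finset.univ.erase k, a j * W j := by
    funext t
    rw [dotProduct, ← Finset.add_sum_erase _ _ (Finset.mem_univ k), Function.update_self]
    congr 1
    exact Finset.sum_congr rfl fun j hj => by
      rw [Function.update_of_ne (Finset.ne_of_mem_erase hj)]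
  rw [this]
  exact (((hasDerivAt_id' x).const_mul (a k)).add_const _).congr_deriv (mul_one _)

end IntegrationByParts

end NNP

/-! ### Gaussian comparison by interpolation. -/

namespace NNP

/-- The sum of the exponentials of the linear forms `β a_i`. -/
noncomputable def expSum {ι N : Type*} [Fintype ι] [Fintype N] (β : ℝ) (a : N → ι → ℝ)
    (W : ι → ℝ) : ℝ :=
  ∑ i, Real.exp (β * (a i ⬝ᵥ W))

section Comparison

variable {ι N : Type*} [Fintype ι] [Fintype N] {β α : ℝ} {a : N → ι → ℝ}

lemma exp_le_expSum (β : ℝ) (a : N → ι → ℝ) (W : ι → ℝ) (i : N) :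
    Real.exp (β * (a i ⬝ᵥ W)) ≤ expSum β a W :=
  Finset.single_le_sum (f := fun i => Real.exp (β * (a i ⬝ᵥ W)))
    (fun _ _ => (Real.exp_pos _).le) (Finset.mem_univ i)

lemma ExpGrowth.exp_mul_dotProduct (β : ℝ) (a : ι → ℝ) :
    ExpGrowth fun W => Real.exp (β * (a ⬝ᵥ W)) := by
  simpa only [smul_dotProduct, smul_eq_mul] using ExpGrowth.exp_dotProduct (β • a)

lemma ExpGrowth.expSum (β : ℝ) (a : N → ι → ℝ) : ExpGrowth (expSum β a) :=
  ExpGrowth.sum _ fun i _ => ExpGrowth.exp_mul_dotProduct β (a i)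

lemma expSum_nonneg (β : ℝ) (a : N → ι → ℝ) (W : ι → ℝ) : 0 ≤ expSum β a W :=
  Finset.sum_nonneg fun _ _ => (Real.exp_pos _).le

lemma expSum_pos [Nonempty N] (β : ℝ) (a : N → ι → ℝ) (W : ι → ℝ) : 0 < expSum β a W :=
  (Real.exp_pos _).trans_le (exp_le_expSum β a W (Classical.arbitrary N))

lemma rpow_le_one_add {x : ℝ} (hx : 0 ≤ x) (h0 : 0 ≤ α) (h1 : α ≤ 1) : x ^ α ≤ 1 + x := by
  rcases le_total x 1 with h | h
  · linarith [Real.rpow_le_one hx h h0]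
  · linarith [(Real.rpow_le_rpow_of_exponent_le h h1).trans_eq (Real.rpow_one x)]

lemma continuous_expSum_rpow [Nonempty N] (β : ℝ) (a : N → ι → ℝ) (p : ℝ) :
    Continuous fun W => expSum β a W ^ p :=
  (ExpGrowth.expSum β a).1.rpow_const fun W => Or.inl (expSum_pos β a W).ne'

lemma ExpGrowth.expSum_rpow [Nonempty N] (β : ℝ) (a : N → ι → ℝ) (h0 : 0 ≤ α) (h1 : α ≤ 1) :
    ExpGrowth fun W => NNP.expSum β a W ^ α :=
  ((const 1).add (expSum β a)).mono (continuous_expSum_rpow β a α) fun W => by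
    rw [abs_of_nonneg (Real.rpow_nonneg (expSum_nonneg β a W) _)]
    exact rpow_le_one_add (expSum_nonneg β a W) h0 h1

/-- Each exponential is one summand of `expSum`. Iterated, this controls the negative powers
produced by differentiating `expSum ^ α`. -/
lemma exp_mul_expSum_rpow_le [Nonempty N] (β : ℝ) (a : N → ι → ℝ) (W : ι → ℝ) (i : N) (p : ℝ) :
    Real.exp (β * (a i ⬝ᵥ W)) * expSum β a W ^ (p - 1) ≤ expSum β a W ^ p := by
  have h := expSum_pos β a W
  calc _ ≤ expSum β a W * expSum β a W ^ (p - 1) :=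
        mul_le_mul_of_nonneg_right (exp_le_expSum β a W i) (Real.rpow_nonneg h.le _)
    _ = _ := by rw [Real.rpow_sub_one h.ne']; field_simp

lemma ExpGrowth.exp_mul_expSum_rpow [Nonempty N] (β : ℝ) (a : N → ι → ℝ) (h0 : 0 ≤ α)
    (h1 : α ≤ 1) (i : N) :
    ExpGrowth fun W => Real.exp (β * (a i ⬝ᵥ W)) * NNP.expSum β a W ^ (α - 1) :=
  (expSum_rpow β a h0 h1).mono
    ((exp_mul_dotProduct β (a i)).1.mul (continuous_expSum_rpow β a _)) fun W => by
      rw [abs_of_nonneg (mul_nonneg (Real.exp_pos _).le (Real.rpow_nonneg (expSum_nonneg β a W) _))]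
      exact exp_mul_expSum_rpow_le β a W i α

lemma ExpGrowth.exp_mul_exp_mul_expSum_rpow [Nonempty N] (β : ℝ) (a : N → ι → ℝ) (h0 : 0 ≤ α)
    (h1 : α ≤ 1) (i j : N) :
    ExpGrowth fun W => Real.exp (β * (a i ⬝ᵥ W)) *
      (Real.exp (β * (a j ⬝ᵥ W)) * NNP.expSum β a W ^ (α - 1 - 1)) :=
  (expSum_rpow β a h0 h1).mono ((exp_mul_dotProduct β (a i)).1.mul
    ((exp_mul_dotProduct β (a j)).1.mul (continuous_expSum_rpow β a _))) fun W => by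
      have h := Real.rpow_nonneg (expSum_nonneg β a W) (α - 1 - 1)
      rw [abs_of_nonneg (by positivity)]
      exact (mul_le_mul_of_nonneg_left (exp_mul_expSum_rpow_le β a W j (α - 1))
        (Real.exp_pos _).le).trans (exp_mul_expSum_rpow_le β a W i α)

/-- Integration by parts in direction `b` gives a multiple of `b ⬝ᵥ a i = 0` from the exponential,
and from the power of the sum terms with factor `(α - 1) * (b ⬝ᵥ a j)`, a product of two nonpositive
numbers. -/
lemma integral_dotProduct_mul_expSum_nonneg [Nonempty N] (hβ : 0 ≤ β) (h0 : 0 ≤ α) (h1 : α ≤ 1)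
    (b : ι → ℝ) (i : N) (hi : b ⬝ᵥ a i = 0) (hj : ∀ j, b ⬝ᵥ a j ≤ 0) :
    0 ≤ ∫ W, (b ⬝ᵥ W) * (Real.exp (β * (a i ⬝ᵥ W)) * expSum β a W ^ (α - 1)) ∂stdGauss ι := by
  classical
  have hexp : ∀ j k W x, HasDerivAt (fun t => Real.exp (β * (a j ⬝ᵥ Function.update W k t)))
      (Real.exp (β * (a j ⬝ᵥ Function.update W k x)) * (β * a j k)) x := fun j k W x =>
    ((hasDerivAt_dotProduct_update (a j) W k x).const_mul β).exp
  have hg := ExpGrowth.exp_mul_expSum_rpow β a h0 h1 i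
  have hg2 := ExpGrowth.exp_mul_exp_mul_expSum_rpow β a h0 h1 i
  rw [integral_dotProduct_mul_stdGauss b (f' := fun k W =>
    (Real.exp (β * (a i ⬝ᵥ W)) * expSum β a W ^ (α - 1)) * (β * a i k) +
      ∑ j, (Real.exp (β * (a i ⬝ᵥ W)) * (Real.exp (β * (a j ⬝ᵥ W)) *
        expSum β a W ^ (α - 1 - 1))) * ((α - 1) * (β * a j k))) (fun k W x => ?_) hg fun k => ?_]
  · refine integral_nonneg fun W => ?_
    simp only [Pi.zero_apply, mul_add, Finset.sum_add_distrib, Finset.mul_sum]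
    rw [Finset.sum_comm (s := Finset.univ (α := ι)) (t := Finset.univ (α := N))]
    have e1 : ∀ c j, ∑ k, b k * (c * (β * a j k)) = c * β * (b ⬝ᵥ a j) := fun c j => by
      rw [dotProduct, Finset.mul_sum]
      exact Finset.sum_congr rfl fun k _ => by ring
    have e2 : ∀ c j, ∑ k, b k * (c * ((α - 1) * (β * a j k))) =
        c * β * ((1 - α) * -(b ⬝ᵥ a j)) := fun c j => by
      rw [dotProduct, ← Finset.sum_neg_distrib, Finset.mul_sum, Finset.mul_sum]
      exact Finset.sum_congr rfl fun k _ => by ring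
    simp_rw [e1, e2, hi, mul_zero, zero_add]
    refine Finset.sum_nonneg fun j _ => ?_
    have h := Real.rpow_nonneg (expSum_nonneg β a W) (α - 1 - 1)
    have := hj j
    have h3 : 0 ≤ (1 - α) * -(b ⬝ᵥ a j) := mul_nonneg (by linarith) (by linarith)
    positivity
  · have hS : HasDerivAt (fun t => expSum β a (Function.update W k t))
        (∑ j, Real.exp (β * (a j ⬝ᵥ Function.update W k x)) * (β * a j k)) x :=
      HasDerivAt.fun_sum fun j _ => hexp j k W x
    refine ((hexp i k W x).mul (hS.rpow_const (p := α - 1)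
      (Or.inl (expSum_pos β a _).ne'))).congr_deriv ?_
    simp only [Finset.sum_mul, Finset.mul_sum]
    congr 1
    · ring
    · exact Finset.sum_congr rfl fun j _ => by ring
  · exact (hg.mul (ExpGrowth.const _)).add
      (ExpGrowth.sum _ fun j _ => (hg2 j).mul (ExpGrowth.const _))

/-- A Gaussian comparison inequality of Slepian and Kahane type for two orthogonal families of
linear forms. -/
theorem integral_expSum_rpow_le [Nonempty N] (hβ : 0 ≤ β) (h0 : 0 ≤ α) (h1 : α ≤ 1)
    {x y : N → ι → ℝ} (hxy : ∀ i j, x i ⬝ᵥ y j = 0) (hdiag : ∀ i, x i ⬝ᵥ x i = y i ⬝ᵥ y i)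
    (hcov : ∀ i j, y i ⬝ᵥ y j ≤ x i ⬝ᵥ x j) :
    ∫ W, expSum β x W ^ α ∂stdGauss ι ≤ ∫ W, expSum β y W ^ α ∂stdGauss ι := by
  -- Rotation from `x` to `y`. Orthogonality makes the two Gaussian families independent, so one
  -- vector `W` carries the whole path.
  let z : ℝ → N → ι → ℝ := fun s i => Real.cos s • x i + Real.sin s • y i
  let z' : ℝ → N → ι → ℝ := fun s i => -Real.sin s • x i + Real.cos s • y i
  let F' : ℝ → (ι → ℝ) → ℝ := fun s W =>
    ∑ i, α * β * ((z' s i ⬝ᵥ W) * (Real.exp (β * (z s i ⬝ᵥ W)) * expSum β (z s) W ^ (α - 1)))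
  let c : ℝ := ∑ i, ((∑ k, |x i k|) + ∑ k, |y i k|)
  have hc : ∀ i, (∑ k, |x i k|) + ∑ k, |y i k| ≤ c := fun i =>
    Finset.single_le_sum (f := fun i => (∑ k, |x i k|) + ∑ k, |y i k|)
      (fun _ _ => by positivity) (Finset.mem_univ i)
  have habs : ∀ i (u w : ℝ) (W : ι → ℝ), |u| ≤ 1 → |w| ≤ 1 →
      |(u • x i + w • y i) ⬝ᵥ W| ≤ c * ∑ k, |W k| := by
    intro i u w W hu hw
    have hW : 0 ≤ ∑ k, |W k| := Finset.sum_nonneg fun _ _ => abs_nonneg _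
    rw [add_dotProduct, smul_dotProduct, smul_dotProduct, smul_eq_mul, smul_eq_mul]
    refine (abs_add_le _ _).trans ?_
    rw [abs_mul, abs_mul]
    have e1 := mul_le_mul hu (abs_dotProduct_le (x i) W) (abs_nonneg _) zero_le_one
    have e2 := mul_le_mul hw (abs_dotProduct_le (y i) W) (abs_nonneg _) zero_le_one
    have e3 := mul_le_mul_of_nonneg_right (hc i) hW
    linarith
  have hz : ∀ s i W, |z s i ⬝ᵥ W| ≤ c * ∑ k, |W k| := fun s i W =>
    habs i _ _ W (Real.abs_cos_le_one s) (Real.abs_sin_le_one s)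
  have hz' : ∀ s i W, |z' s i ⬝ᵥ W| ≤ c * ∑ k, |W k| := fun s i W =>
    habs i _ _ W (by rw [abs_neg]; exact Real.abs_sin_le_one s) (Real.abs_cos_le_one s)
  have hS : ∀ s W, expSum β (z s) W ≤ Fintype.card N * Real.exp (β * c * ∑ k, |W k|) := by
    intro s W
    rw [← nsmul_eq_mul, ← Finset.card_univ, ← Finset.sum_const]
    refine Finset.sum_le_sum fun i _ => Real.exp_le_exp.2 ?_
    rw [mul_assoc]
    exact mul_le_mul_of_nonneg_left ((le_abs_self _).trans (hz s i W)) hβ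
  -- A majorant of the `s`-derivative that is uniform in `s`, for differentiation under the
  -- integral.
  let bound : (ι → ℝ) → ℝ := fun W => ∑ _i : N, α * β * ((c * ∑ k, |W k|) *
    (1 + Fintype.card N * Real.exp (β * c * ∑ k, |W k|)))
  have hbound : ExpGrowth bound := ExpGrowth.sum _ fun i _ => (ExpGrowth.const _).mul
    (((ExpGrowth.const c).mul ExpGrowth.sum_abs).mul ((ExpGrowth.const 1).add
      ((ExpGrowth.const _).mul (ExpGrowth.exp_sum_abs _))))
  have hF' : ∀ s W, |F' s W| ≤ bound W := by
    intro s W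
    refine (Finset.abs_sum_le_sum_abs _ _).trans (Finset.sum_le_sum fun i _ => ?_)
    have hp := Real.rpow_nonneg (expSum_nonneg β (z s) W) (α - 1)
    have e1 := ((exp_mul_expSum_rpow_le β (z s) W i α).trans
      (rpow_le_one_add (expSum_nonneg β (z s) W) h0 h1)).trans (add_le_add_right (hS s W) 1)
    rw [abs_mul, abs_mul (z' s i ⬝ᵥ W), abs_of_nonneg (mul_nonneg h0 hβ),
      abs_of_nonneg (mul_nonneg (Real.exp_pos _).le hp)]
    exact mul_le_mul_of_nonneg_left (mul_le_mul (hz' s i W) e1 (by positivity)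
      ((abs_nonneg _).trans (hz' s i W))) (mul_nonneg h0 hβ)
  have hzd : ∀ s i W, HasDerivAt (fun s => z s i ⬝ᵥ W) (z' s i ⬝ᵥ W) s := by
    intro s i W
    simp only [z, z', add_dotProduct, smul_dotProduct, smul_eq_mul]
    exact ((Real.hasDerivAt_cos s).mul_const _).add ((Real.hasDerivAt_sin s).mul_const _)
  have hFd : ∀ W s, HasDerivAt (fun s => expSum β (z s) W ^ α) (F' s W) s := by
    intro W s
    have hSd : HasDerivAt (fun s => expSum β (z s) W)
        (∑ i, Real.exp (β * (z s i ⬝ᵥ W)) * (β * (z' s i ⬝ᵥ W))) s :=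
      HasDerivAt.fun_sum fun i _ => ((hzd s i W).const_mul β).exp
    refine (hSd.rpow_const (p := α) (Or.inl (expSum_pos β _ W).ne')).congr_deriv ?_
    simp only [F', Finset.sum_mul]
    exact Finset.sum_congr rfl fun i _ => by ring
  have hF'g : ∀ s, ExpGrowth (F' s) := fun s => ExpGrowth.sum _ fun i _ =>
    (ExpGrowth.const _).mul (((ExpGrowth.sum Finset.univ fun k _ => (ExpGrowth.const (z' s i k)).mul
      (ExpGrowth.eval k))).mul (ExpGrowth.exp_mul_expSum_rpow β (z s) h0 h1 i))
  have hφ : ∀ s, HasDerivAt (fun s => ∫ W, expSum β (z s) W ^ α ∂stdGauss ι)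
      (∫ W, F' s W ∂stdGauss ι) s := by
    intro s
    refine (hasDerivAt_integral_of_dominated_loc_of_deriv_le (bound := bound) Filter.univ_mem
      (Filter.Eventually.of_forall fun s => ?_) (ExpGrowth.expSum_rpow β (z s) h0 h1).integrable
      (hF'g s).1.aestronglyMeasurable (Filter.Eventually.of_forall fun W s _ => hF' s W)
      hbound.integrable (Filter.Eventually.of_forall fun W s _ => hFd W s)).2
    exact (ExpGrowth.expSum_rpow β (z s) h0 h1).1.aestronglyMeasurable
  -- Only the covariance difference survives: it is zero for `i = j` and nonpositive otherwise,
  -- while `sin s * cos s ≥ 0` on the quarter circle.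
  have hdot : ∀ s i j, z' s i ⬝ᵥ z s j =
      Real.sin s * Real.cos s * (y i ⬝ᵥ y j - x i ⬝ᵥ x j) := by
    intro s i j
    simp only [z, z', add_dotProduct, smul_dotProduct, dotProduct_add, dotProduct_smul,
      smul_eq_mul, hxy, dotProduct_comm (y i) (x j)]
    ring
  have hmono : MonotoneOn (fun s => ∫ W, expSum β (z s) W ^ α ∂stdGauss ι)
      (Set.Icc 0 (Real.pi / 2)) := by
    refine monotoneOn_of_deriv_nonneg (convex_Icc _ _)
      (fun s _ => (hφ s).continuousAt.continuousWithinAt)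
      (fun s _ => (hφ s).differentiableAt.differentiableWithinAt) fun s hs => ?_
    rw [interior_Icc] at hs
    rw [(hφ s).deriv, integral_finsetSum _ fun i _ => ?_]
    · refine Finset.sum_nonneg fun i _ => ?_
      rw [integral_const_mul]
      refine mul_nonneg (mul_nonneg h0 hβ) (integral_dotProduct_mul_expSum_nonneg hβ h0 h1 _ i ?_
        fun j => ?_)
      · rw [hdot, hdiag, sub_self, mul_zero]
      · rw [hdot]
        refine mul_nonpos_of_nonneg_of_nonpos (mul_nonneg ?_ ?_) (sub_nonpos.2 (hcov i j))
        · exact Real.sin_nonneg_of_nonneg_of_le_pi hs.1.le (by linarith [Real.pi_pos, hs.2])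
        · exact Real.cos_nonneg_of_mem_Icc ⟨by linarith [Real.pi_pos, hs.1], hs.2.le⟩
    · exact ((ExpGrowth.const _).mul (((ExpGrowth.sum Finset.univ fun k _ =>
        (ExpGrowth.const (z' s i k)).mul (ExpGrowth.eval k))).mul
          (ExpGrowth.exp_mul_expSum_rpow β (z s) h0 h1 i))).integrable
  have := hmono (Set.left_mem_Icc.2 (by positivity)) (Set.right_mem_Icc.2 (by positivity))
    (by positivity : (0 : ℝ) ≤ Real.pi / 2)
  simpa [z] using this

end Comparison

end NNP

/-! ### Laplace transform of the norm of a projected Gaussian vector. -/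

namespace NNP

section GaussianNorm

variable {ι : Type*} [Fintype ι]

/-- A smooth upper bound of the Euclidean norm of `R W`. -/
noncomputable def smoothNorm (ε : ℝ) (R : Matrix ι ι ℝ) (W : ι → ℝ) : ℝ :=
  √(ε ^ 2 + (R *ᵥ W) ⬝ᵥ (R *ᵥ W))

lemma dotProduct_self_nonneg (w : ι → ℝ) : 0 ≤ w ⬝ᵥ w :=
  Finset.sum_nonneg fun _ _ => mul_self_nonneg _

lemma continuous_smoothNorm (ε : ℝ) (R : Matrix ι ι ℝ) : Continuous (smoothNorm ε R) := by
  unfold smoothNorm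
  simp only [Matrix.mulVec, dotProduct]
  fun_prop

lemma smoothNorm_sq (ε : ℝ) (R : Matrix ι ι ℝ) (W : ι → ℝ) :
    smoothNorm ε R W ^ 2 = ε ^ 2 + (R *ᵥ W) ⬝ᵥ (R *ᵥ W) :=
  Real.sq_sqrt (by have := dotProduct_self_nonneg (R *ᵥ W); positivity)

lemma smoothNorm_nonneg (ε : ℝ) (R : Matrix ι ι ℝ) (W : ι → ℝ) : 0 ≤ smoothNorm ε R W :=
  Real.sqrt_nonneg _

lemma smoothNorm_pos {ε : ℝ} (hε : 0 < ε) (R : Matrix ι ι ℝ) (W : ι → ℝ) :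
    0 < smoothNorm ε R W :=
  Real.sqrt_pos.2 (by have := dotProduct_self_nonneg (R *ᵥ W); positivity)

lemma exists_smoothNorm_le (ε : ℝ) (R : Matrix ι ι ℝ) :
    ∃ c, 0 ≤ c ∧ ∀ W, smoothNorm ε R W ≤ |ε| + c * ∑ k, |W k| := by
  refine ⟨∑ k, ∑ j, |R k j|, by positivity, fun W => ?_⟩
  have h1 : ∀ k, |(R *ᵥ W) k| ≤ (∑ j, |R k j|) * ∑ k, |W k| := fun k => abs_dotProduct_le _ _
  have h2 : (R *ᵥ W) ⬝ᵥ (R *ᵥ W) ≤ (∑ k, |(R *ᵥ W) k|) ^ 2 := by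
    rw [sq, Finset.sum_mul]
    refine Finset.sum_le_sum fun k _ => ?_
    rw [← abs_mul_abs_self]
    exact mul_le_mul_of_nonneg_left (Finset.single_le_sum (f := fun k => |(R *ᵥ W) k|)
      (fun _ _ => abs_nonneg _) (Finset.mem_univ k)) (abs_nonneg _)
  have h3 : 0 ≤ ∑ k, |(R *ᵥ W) k| := by positivity
  have h4 : ∑ k, |(R *ᵥ W) k| ≤ (∑ k, ∑ j, |R k j|) * ∑ k, |W k| := by
    rw [Finset.sum_mul]; exact Finset.sum_le_sum fun k _ => h1 k
  refine le_trans (Real.sqrt_le_iff.2 ⟨by positivity, ?_⟩) (add_le_add_right h4 _)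
  nlinarith [abs_nonneg ε, sq_abs ε, mul_nonneg (abs_nonneg ε) h3]

lemma ExpGrowth.smoothNorm (ε : ℝ) (R : Matrix ι ι ℝ) : ExpGrowth (smoothNorm ε R) := by
  obtain ⟨c, hc, h⟩ := exists_smoothNorm_le ε R
  refine ((const |ε|).add ((const c).mul sum_abs)).mono (continuous_smoothNorm ε R) fun W => ?_
  rw [abs_of_nonneg (smoothNorm_nonneg ε R W)]
  exact h W

lemma ExpGrowth.exp_smoothNorm (l ε : ℝ) (R : Matrix ι ι ℝ) :
    ExpGrowth fun W => Real.exp (l * NNP.smoothNorm ε R W) := by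
  obtain ⟨c, hc, h⟩ := exists_smoothNorm_le ε R
  refine ((const (Real.exp (|l| * |ε|))).mul (exp_sum_abs (|l| * c))).mono
    ((continuous_smoothNorm ε R).const_mul l).rexp fun W => ?_
  rw [abs_of_pos (Real.exp_pos _), ← Real.exp_add, Real.exp_le_exp]
  have h1 := mul_le_mul_of_nonneg_left (h W) (abs_nonneg l)
  have h2 := mul_le_mul_of_nonneg_right (le_abs_self l) (smoothNorm_nonneg ε R W)
  linarith

/-- Stein's identity for the field `RW exp(lρ)`, with `ρ` the smoothed norm: `W · RW = ρ² - ε²`, and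
the divergence yields `R.trace` from the linear factor and `l|RW|²/ρ ≤ lρ` from the exponential.
Taking `ε > 0` makes `ρ` differentiable where `RW = 0`. -/
lemma integral_smoothNorm_sq_mul_exp_le {ε l : ℝ} (hε : 0 < ε) (hl : 0 ≤ l) {R : Matrix ι ι ℝ}
    (hR : Rᵀ = R) (hRR : R * R = R) :
    ∫ W, smoothNorm ε R W ^ 2 * Real.exp (l * smoothNorm ε R W) ∂stdGauss ι ≤
      (R.trace + ε ^ 2) * ∫ W, Real.exp (l * smoothNorm ε R W) ∂stdGauss ι +
        l * ∫ W, smoothNorm ε R W * Real.exp (l * smoothNorm ε R W) ∂stdGauss ι := by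
  classical
  have hcol : ∀ W, W ⬝ᵥ (R *ᵥ W) = (R *ᵥ W) ⬝ᵥ (R *ᵥ W) := by
    intro W
    conv_rhs => rw [Matrix.dotProduct_mulVec, Matrix.vecMul_mulVec, hR, hRR]
    exact Matrix.dotProduct_mulVec _ _ _
  have hlin : ∀ j k W x, HasDerivAt (fun t => (R *ᵥ Function.update W k t) j) (R j k) x :=
    fun j k W x => hasDerivAt_dotProduct_update (R j) W k x
  have hρ : ∀ k W x, HasDerivAt (fun t => smoothNorm ε R (Function.update W k t))
      ((R *ᵥ Function.update W k x) k / smoothNorm ε R (Function.update W k x)) x := by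
    intro k W x
    have h1 : HasDerivAt (fun t => ε ^ 2 +
        (R *ᵥ Function.update W k t) ⬝ᵥ (R *ᵥ Function.update W k t))
        (∑ j, (R j k * (R *ᵥ Function.update W k x) j + (R *ᵥ Function.update W k x) j * R j k))
        x :=
      (HasDerivAt.fun_sum fun j _ => (hlin j k W x).mul (hlin j k W x)).const_add _
    have hne := (smoothNorm_pos hε R (Function.update W k x)).ne'
    have h0 : ε ^ 2 + (R *ᵥ Function.update W k x) ⬝ᵥ (R *ᵥ Function.update W k x) ≠ 0 := by
      rw [← smoothNorm_sq]; positivity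
    refine (h1.sqrt h0).congr_deriv ?_
    have h2 : ∑ j, (R j k * (R *ᵥ Function.update W k x) j +
        (R *ᵥ Function.update W k x) j * R j k) = 2 * (R *ᵥ Function.update W k x) k := by
      have h3 : ∑ j, R j k * (R *ᵥ Function.update W k x) j =
          (Rᵀ *ᵥ (R *ᵥ Function.update W k x)) k := rfl
      rw [Finset.sum_add_distrib]
      simp_rw [mul_comm ((R *ᵥ Function.update W k x) _)]
      rw [h3, hR, Matrix.mulVec_mulVec, hRR]
      ring
    rw [h2]
    change 2 * _ / (2 * smoothNorm ε R (Function.update W k x)) = _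
    field_simp
  have hRW : ∀ k, ExpGrowth fun W => (R *ᵥ W) k := fun k =>
    ExpGrowth.sum Finset.univ fun j _ => (ExpGrowth.const (R k j)).mul (ExpGrowth.eval j)
  have hE := ExpGrowth.exp_smoothNorm l ε R
  have hdiv : ∀ k, ExpGrowth fun W => (R *ᵥ W) k * ((R *ᵥ W) k / smoothNorm ε R W) := by
    intro k
    refine (((hRW k).mul (hRW k)).mul (ExpGrowth.const ε⁻¹)).mono ((hRW k).1.mul
      ((hRW k).1.div (continuous_smoothNorm ε R) fun W => (smoothNorm_pos hε R W).ne')) fun W => ?_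
    have hp := smoothNorm_pos hε R W
    have : (R *ᵥ W) k * ((R *ᵥ W) k / smoothNorm ε R W) =
        (R *ᵥ W) k * (R *ᵥ W) k * (smoothNorm ε R W)⁻¹ := by ring
    rw [this, abs_of_nonneg (mul_nonneg (mul_self_nonneg _) (inv_nonneg.2 hp.le))]
    refine mul_le_mul_of_nonneg_left (inv_anti₀ hε ?_) (mul_self_nonneg _)
    refine Real.le_sqrt_of_sq_le ?_
    linarith [dotProduct_self_nonneg (R *ᵥ W)]
  have hibp : ∀ k, ∫ W, W k * ((R *ᵥ W) k * Real.exp (l * smoothNorm ε R W)) ∂stdGauss ι =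
      ∫ W, (R k k * Real.exp (l * smoothNorm ε R W) +
        l * (((R *ᵥ W) k * ((R *ᵥ W) k / smoothNorm ε R W)) *
          Real.exp (l * smoothNorm ε R W))) ∂stdGauss ι := by
    intro k
    refine integral_eval_mul_stdGauss k (fun W x => ?_) ((hRW k).mul hE)
      (((ExpGrowth.const _).mul hE).add ((ExpGrowth.const l).mul ((hdiv k).mul hE)))
    refine ((hlin k k W x).mul ((hρ k W x).const_mul l).exp).congr_deriv ?_
    ring
  have hsum := Finset.sum_congr rfl fun k (_ : k ∈ Finset.univ) => hibp k
  rw [← integral_finsetSum _ fun k _ => ((ExpGrowth.eval k).mul ((hRW k).mul hE)).integrable,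
    ← integral_finsetSum _ fun k _ => (((ExpGrowth.const _).mul hE).add
      ((ExpGrowth.const l).mul ((hdiv k).mul hE))).integrable] at hsum
  have hleft : ∀ W : ι → ℝ, ∑ k, W k * ((R *ᵥ W) k * Real.exp (l * smoothNorm ε R W)) =
      smoothNorm ε R W ^ 2 * Real.exp (l * smoothNorm ε R W) -
        ε ^ 2 * Real.exp (l * smoothNorm ε R W) := by
    intro W
    simp_rw [← mul_assoc]
    rw [← Finset.sum_mul, smoothNorm_sq, ← hcol]
    simp only [dotProduct]
    ring
  have hright : ∀ W : ι → ℝ, ∑ k, (R k k * Real.exp (l * smoothNorm ε R W) +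
        l * (((R *ᵥ W) k * ((R *ᵥ W) k / smoothNorm ε R W)) *
          Real.exp (l * smoothNorm ε R W))) ≤
      R.trace * Real.exp (l * smoothNorm ε R W) +
        l * (smoothNorm ε R W * Real.exp (l * smoothNorm ε R W)) := by
    intro W
    rw [Finset.sum_add_distrib, ← Finset.sum_mul, ← Finset.mul_sum, ← Finset.sum_mul]
    have h1 : ∑ k, (R *ᵥ W) k * ((R *ᵥ W) k / smoothNorm ε R W) ≤ smoothNorm ε R W := by
      have hp := smoothNorm_pos hε R W
      simp_rw [← mul_div_assoc]
      rw [← Finset.sum_div, div_le_iff₀ hp, ← sq, smoothNorm_sq]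
      exact le_add_of_nonneg_left (sq_nonneg ε)
    exact add_le_add_right (mul_le_mul_of_nonneg_left
      (mul_le_mul_of_nonneg_right h1 (Real.exp_pos _).le) hl) _
  have hρg := ExpGrowth.smoothNorm ε R
  have hmono := integral_mono (ExpGrowth.sum Finset.univ fun k _ =>
    (((ExpGrowth.const _).mul hE).add ((ExpGrowth.const l).mul ((hdiv k).mul hE)))).integrable
    (((ExpGrowth.const R.trace).mul hE).add ((ExpGrowth.const l).mul (hρg.mul hE))).integrable
    hright
  rw [← hsum] at hmono
  simp_rw [hleft] at hmono
  have hsq : ExpGrowth fun W => smoothNorm ε R W ^ 2 * Real.exp (l * smoothNorm ε R W) := by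
    simp_rw [sq]; exact (hρg.mul hρg).mul hE
  rw [integral_sub hsq.integrable ((ExpGrowth.const _).mul hE).integrable,
    integral_add ((ExpGrowth.const _).mul hE).integrable
      ((ExpGrowth.const l).mul (hρg.mul hE)).integrable,
    integral_const_mul, integral_const_mul, integral_const_mul] at hmono
  linarith

lemma trace_nonneg_of_isProj {R : Matrix ι ι ℝ} (hR : Rᵀ = R) (hRR : R * R = R) :
    0 ≤ R.trace := by
  have : R.trace = (Rᵀ * R).trace := by rw [hR, hRR]
  rw [this]
  exact Finset.sum_nonneg fun i _ => Finset.sum_nonneg fun j _ => mul_self_nonneg _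

/-- For the moment generating function `M`, Stein's bound combined with `(ρ - (r + l))² ≥ 0` gives
`M' ≤ (r + l)M`, which integrates to the claim. -/
lemma integral_exp_smoothNorm_le {ε l : ℝ} (hε : 0 < ε) (hl : 0 ≤ l) {R : Matrix ι ι ℝ}
    (hR : Rᵀ = R) (hRR : R * R = R) :
    ∫ W, Real.exp (l * smoothNorm ε R W) ∂stdGauss ι ≤
      Real.exp (l * √(R.trace + ε ^ 2) + l ^ 2 / 2) := by
  set r := √(R.trace + ε ^ 2) with hr
  have htr := trace_nonneg_of_isProj hR hRR
  have hr2 : R.trace + ε ^ 2 = r ^ 2 := (Real.sq_sqrt (by positivity)).symm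
  have hr0 : 0 < r := Real.sqrt_pos.2 (by positivity)
  have hE := fun l => ExpGrowth.exp_smoothNorm l ε R
  have hρ := ExpGrowth.smoothNorm ε R
  have hset : integrableExpSet (smoothNorm ε R) (stdGauss ι) = Set.univ :=
    Set.eq_univ_of_forall fun l => (hE l).integrable
  have hd : ∀ l, HasDerivAt (mgf (smoothNorm ε R) (stdGauss ι))
      (∫ W, smoothNorm ε R W * Real.exp (l * smoothNorm ε R W) ∂stdGauss ι) l := fun l =>
    hasDerivAt_mgf (by rw [hset, interior_univ]; exact Set.mem_univ _)
  have hle : ∀ l, 0 ≤ l → ∫ W, smoothNorm ε R W * Real.exp (l * smoothNorm ε R W) ∂stdGauss ι ≤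
      (r + l) * mgf (smoothNorm ε R) (stdGauss ι) l := by
    intro l hl
    have h1 := integral_smoothNorm_sq_mul_exp_le hε hl hR hRR
    have hsq : ExpGrowth fun W => smoothNorm ε R W ^ 2 * Real.exp (l * smoothNorm ε R W) := by
      simp_rw [sq]; exact (hρ.mul hρ).mul (hE l)
    have h2 : 0 ≤ ∫ W, ((smoothNorm ε R W ^ 2 * Real.exp (l * smoothNorm ε R W) +
        (r + l) ^ 2 * Real.exp (l * smoothNorm ε R W)) -
          2 * (r + l) * (smoothNorm ε R W * Real.exp (l * smoothNorm ε R W))) ∂stdGauss ι := by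
      refine integral_nonneg fun W => ?_
      have : 0 ≤ (smoothNorm ε R W - (r + l)) ^ 2 * Real.exp (l * smoothNorm ε R W) := by
        positivity
      simp only [Pi.zero_apply]
      linarith
    have i2 := (ExpGrowth.const ((r + l) ^ 2)).mul (hE l)
    rw [integral_sub (hsq.add i2).integrable
      ((ExpGrowth.const (2 * (r + l))).mul (hρ.mul (hE l))).integrable,
      integral_add hsq.integrable i2.integrable, integral_const_mul, integral_const_mul] at h2
    rw [hr2] at h1
    change _ ≤ _ * mgf (smoothNorm ε R) (stdGauss ι) l + _ at h1
    change 0 ≤ _ + _ * mgf (smoothNorm ε R) (stdGauss ι) l - _ at h2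
    have hm : 0 ≤ mgf (smoothNorm ε R) (stdGauss ι) l := mgf_nonneg
    generalize mgf (smoothNorm ε R) (stdGauss ι) l = M at *
    generalize ∫ W, smoothNorm ε R W * Real.exp (l * smoothNorm ε R W) ∂stdGauss ι = M' at *
    -- The two inequalities give `(2r + l)M' ≤ (2r² + 2rl + l²)M = (2r + l)(r + l)M - rlM`.
    by_contra! hlt
    have h3 : (2 * r + l) * ((r + l) * M) < (2 * r + l) * M' :=
      mul_lt_mul_of_pos_left hlt (by positivity)
    nlinarith [mul_nonneg (mul_nonneg hl hr0.le) hm]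
  let G : ℝ → ℝ := fun l => mgf (smoothNorm ε R) (stdGauss ι) l * Real.exp (-(l * r + l ^ 2 / 2))
  have hG : ∀ l, HasDerivAt G
      ((∫ W, smoothNorm ε R W * Real.exp (l * smoothNorm ε R W) ∂stdGauss ι -
        (r + l) * mgf (smoothNorm ε R) (stdGauss ι) l) * Real.exp (-(l * r + l ^ 2 / 2))) l := by
    intro l
    have h1 : HasDerivAt (fun l : ℝ => -(l * r + l ^ 2 / 2)) (-(r + l)) l := by
      refine (((hasDerivAt_id' l).mul_const r).add
        (((hasDerivAt_id' l).pow 2).div_const 2)).neg.congr_deriv ?_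
      simp
    refine ((hd l).mul h1.exp).congr_deriv ?_
    ring
  have hanti : AntitoneOn G (Set.Ici 0) := by
    refine antitoneOn_of_deriv_nonpos (convex_Ici 0)
      (fun l _ => (hG l).continuousAt.continuousWithinAt)
      (fun l _ => (hG l).differentiableAt.differentiableWithinAt) fun l hl => ?_
    rw [interior_Ici] at hl
    rw [(hG l).deriv]
    exact mul_nonpos_of_nonpos_of_nonneg (sub_nonpos.2 (hle l (le_of_lt hl))) (Real.exp_pos _).le
  have := hanti (Set.self_mem_Ici) (Set.mem_Ici.2 hl) hl
  simp only [G, mgf_zero, zero_mul, Real.exp_neg] at this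
  rw [mul_inv_le_iff₀ (Real.exp_pos _)] at this
  simpa [mgf] using this

/-- The Laplace transform of the norm of the projection of a standard Gaussian vector. -/
theorem integral_exp_norm_proj_le {l : ℝ} (hl : 0 ≤ l) {R : Matrix ι ι ℝ}
    (hR : Rᵀ = R) (hRR : R * R = R) :
    ∫ W, Real.exp (l * smoothNorm 0 R W) ∂stdGauss ι ≤
      Real.exp (l * √R.trace + l ^ 2 / 2) := by
  have hlim : Filter.Tendsto (fun ε : ℝ => Real.exp (l * √(R.trace + ε ^ 2) + l ^ 2 / 2))
      (nhdsWithin 0 (Set.Ioi 0)) (nhds (Real.exp (l * √R.trace + l ^ 2 / 2))) := by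
    have : Continuous fun ε : ℝ => Real.exp (l * √(R.trace + ε ^ 2) + l ^ 2 / 2) := by fun_prop
    simpa using (this.tendsto 0).mono_left nhdsWithin_le_nhds
  refine ge_of_tendsto hlim (eventually_nhdsWithin_of_forall fun ε hε => ?_)
  refine le_trans ?_ (integral_exp_smoothNorm_le hε hl hR hRR)
  refine integral_mono (ExpGrowth.exp_smoothNorm l 0 R).integrable
    (ExpGrowth.exp_smoothNorm l ε R).integrable fun W => ?_
  refine Real.exp_le_exp.2 (mul_le_mul_of_nonneg_left (Real.sqrt_le_sqrt ?_) hl)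
  nlinarith

end GaussianNorm

end NNP

/-! ### Chevet's inequality and the resulting tail bound. -/

namespace NNP

open Matrix

lemma sumElim_dotProduct {ι κ : Type*} [Fintype ι] [Fintype κ] (a : ι → ℝ) (b : κ → ℝ)
    (W : ι ⊕ κ → ℝ) :
    Sum.elim a b ⬝ᵥ W = a ⬝ᵥ (W ∘ Sum.inl) + b ⬝ᵥ (W ∘ Sum.inr) := by
  simp [dotProduct]

section Product

variable {ι κ : Type*} [Fintype ι] [Fintype κ]

lemma measurePreserving_stdGauss_sum :
    MeasurePreserving (fun W : ι ⊕ κ → ℝ => (W ∘ Sum.inl, W ∘ Sum.inr)) (stdGauss (ι ⊕ κ))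
      ((stdGauss ι).prod (stdGauss κ)) :=
  measurePreserving_sumPiEquivProdPi (fun _ : ι ⊕ κ => gaussianReal 0 1)

lemma integral_mul_stdGauss_sum {f : (ι → ℝ) → ℝ} {g : (κ → ℝ) → ℝ}
    (hf : Continuous f) (hg : Continuous g) :
    ∫ W, f (W ∘ Sum.inl) * g (W ∘ Sum.inr) ∂stdGauss (ι ⊕ κ) =
      (∫ W, f W ∂stdGauss ι) * ∫ W, g W ∂stdGauss κ := by
  rw [← integral_prod_mul, ← measurePreserving_stdGauss_sum.map_eq,
    integral_map measurePreserving_stdGauss_sum.measurable.aemeasurable]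
  exact (by fun_prop : Continuous fun z : (ι → ℝ) × (κ → ℝ) => f z.1 * g z.2).aestronglyMeasurable

lemma integral_comp_inl_stdGauss {f : (ι → ℝ) → ℝ} (hf : Continuous f) :
    ∫ W, f (W ∘ Sum.inl) ∂stdGauss (ι ⊕ κ) = ∫ W, f W ∂stdGauss ι := by
  simpa using integral_mul_stdGauss_sum hf (continuous_const (y := (1 : ℝ)) (X := κ → ℝ))

lemma integral_comp_inr_stdGauss {f : (κ → ℝ) → ℝ} (hf : Continuous f) :
    ∫ W, f (W ∘ Sum.inr) ∂stdGauss (ι ⊕ κ) = ∫ W, f W ∂stdGauss κ := by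
  simpa using integral_mul_stdGauss_sum (continuous_const (y := (1 : ℝ)) (X := ι → ℝ)) hf

lemma integral_exp_mul_stdGauss_unit (l : ℝ) :
    ∫ W, Real.exp (l * W ()) ∂stdGauss Unit = Real.exp (l ^ 2 / 2) := by
  have h := measurePreserving_eval (fun _ : Unit => gaussianReal 0 1) ()
  have := mgf_gaussianReal (X := fun W : Unit → ℝ => W ()) h.map_eq l
  simpa [mgf, stdGauss] using this

end Product

section TailBound

variable {μ ν N : Type*} [Fintype μ] [Fintype ν] [Fintype N]

/-- The tensor product of two vectors, as a vector indexed by pairs. -/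
def tensor (u : μ → ℝ) (v : ν → ℝ) : μ × ν → ℝ := fun q => u q.1 * v q.2

lemma tensor_dotProduct_tensor (u u' : μ → ℝ) (v v' : ν → ℝ) :
    tensor u v ⬝ᵥ tensor u' v' = (u ⬝ᵥ u') * (v ⬝ᵥ v') := by
  simp only [tensor, dotProduct, Fintype.sum_prod_type, Finset.sum_mul_sum]
  exact Finset.sum_congr rfl fun i _ => Finset.sum_congr rfl fun j _ => by ring

lemma dotProduct_le_one {u u' : μ → ℝ} (hu : u ⬝ᵥ u = 1) (hu' : u' ⬝ᵥ u' = 1) : u ⬝ᵥ u' ≤ 1 := by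
  have := dotProduct_self_nonneg (u - u')
  simp only [sub_dotProduct, dotProduct_sub, hu, hu', dotProduct_comm u' u] at this
  linarith

lemma dotProduct_le_smoothNorm {u : μ → ℝ} (hu : u ⬝ᵥ u = 1) (R : Matrix μ μ ℝ) (W : μ → ℝ) :
    u ⬝ᵥ (R *ᵥ W) ≤ smoothNorm 0 R W := by
  refine Real.le_sqrt_of_sq_le ?_
  have h := Finset.sum_mul_sq_le_sq_mul_sq Finset.univ u (R *ᵥ W)
  simp only [dotProduct, ← sq] at hu h ⊢
  rw [hu, one_mul] at h
  simpa using h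

/-- Laplace transform form of Chevet's inequality for finitely many pairs of unit vectors. -/
lemma integral_expSum_tensor_le [Nonempty N] {α l : ℝ} (hα : 0 < α) (hα1 : α ≤ 1) (hl : 0 ≤ l)
    {R : Matrix μ μ ℝ} (hR : Rᵀ = R) (hRR : R * R = R) {u : N → μ → ℝ} {v : N → ν → ℝ}
    (hu : ∀ i, u i ⬝ᵥ u i = 1) (hv : ∀ i, v i ⬝ᵥ v i = 1) (hRu : ∀ i, R *ᵥ u i = u i) :
    ∫ W, expSum (l / α) (fun i => tensor (u i) (v i)) W ^ α ∂stdGauss (μ × ν) ≤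
      (Fintype.card N : ℝ) ^ α *
        Real.exp (l * (√R.trace + √(Fintype.card ν : ℝ)) + l ^ 2 / 2) := by
  classical
  set β := l / α with hβ
  have hβ0 : 0 ≤ β := by positivity
  have hβα : β * α = l := by rw [hβ]; field_simp
  -- The `Unit` coordinate is the extra scalar Gaussian: it raises the variance of the tensor
  -- process from 1 to 2, that of `y`.
  let x : N → ((μ × ν) ⊕ Unit) ⊕ (μ ⊕ ν) → ℝ := fun i =>
    Sum.elim (Sum.elim (tensor (u i) (v i)) fun _ => 1) 0
  let y : N → ((μ × ν) ⊕ Unit) ⊕ (μ ⊕ ν) → ℝ := fun i => Sum.elim 0 (Sum.elim (u i) (v i))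
  have hxx : ∀ i j, x i ⬝ᵥ x j = (u i ⬝ᵥ u j) * (v i ⬝ᵥ v j) + 1 := fun i j => by
    simp [x, tensor_dotProduct_tensor]
  have hyy : ∀ i j, y i ⬝ᵥ y j = u i ⬝ᵥ u j + v i ⬝ᵥ v j := fun i j => by simp [y]
  have key := integral_expSum_rpow_le (x := x) (y := y) hβ0 hα.le hα1
    (fun i j => by simp [x, y]) (fun i => by rw [hxx, hyy, hu, hv]; norm_num) fun i j => by
      rw [hxx, hyy]
      nlinarith [dotProduct_le_one (hu i) (hu j), dotProduct_le_one (hv i) (hv j)]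
  have hx : ∀ W, expSum β x W ^ α =
      (fun V : (μ × ν) ⊕ Unit → ℝ => expSum β (fun i => tensor (u i) (v i)) (V ∘ Sum.inl) ^ α *
        Real.exp (l * (V ∘ Sum.inr) ())) (W ∘ Sum.inl) := by
    intro W
    have : expSum β x W = expSum β (fun i => tensor (u i) (v i)) ((W ∘ Sum.inl) ∘ Sum.inl) *
        Real.exp (β * ((W ∘ Sum.inl) ∘ Sum.inr) ()) := by
      rw [expSum, expSum, Finset.sum_mul]
      refine Finset.sum_congr rfl fun i _ => ?_
      rw [← Real.exp_add]
      simp only [x, sumElim_dotProduct]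
      simp [dotProduct, mul_add]
    rw [this, Real.mul_rpow (expSum_nonneg _ _ _) (Real.exp_pos _).le, ← Real.exp_mul]
    congr 2
    rw [← hβα]; ring
  have hcx := continuous_expSum_rpow (ι := μ × ν) β (fun i => tensor (u i) (v i)) α
  simp_rw [hx] at key
  rw [integral_comp_inl_stdGauss (f := fun V : (μ × ν) ⊕ Unit → ℝ =>
      expSum β (fun i => tensor (u i) (v i)) (V ∘ Sum.inl) ^ α * Real.exp (l * (V ∘ Sum.inr) ()))
      ((hcx.comp (by fun_prop)).mul (by fun_prop)),
    integral_mul_stdGauss_sum (g := fun V : Unit → ℝ => Real.exp (l * V ())) hcx (by fun_prop),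
    integral_exp_mul_stdGauss_unit] at key
  have hy : ∀ W, expSum β y W ^ α ≤ (Fintype.card N : ℝ) ^ α *
      (fun V : μ ⊕ ν → ℝ => Real.exp (l * smoothNorm 0 R (V ∘ Sum.inl)) *
        Real.exp (l * smoothNorm 0 (1 : Matrix ν ν ℝ) (V ∘ Sum.inr))) (W ∘ Sum.inr) := by
    intro W
    have h1 : expSum β y W ≤ Fintype.card N * Real.exp (β *
        (smoothNorm 0 R ((W ∘ Sum.inr) ∘ Sum.inl) +
          smoothNorm 0 (1 : Matrix ν ν ℝ) ((W ∘ Sum.inr) ∘ Sum.inr))) := by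
      rw [← nsmul_eq_mul, ← Finset.card_univ, ← Finset.sum_const]
      refine Finset.sum_le_sum fun i _ => Real.exp_le_exp.2 (mul_le_mul_of_nonneg_left ?_ hβ0)
      simp only [y, sumElim_dotProduct, zero_dotProduct, zero_add]
      refine add_le_add ?_ ?_
      · refine le_of_eq_of_le ?_ (dotProduct_le_smoothNorm (hu i) R _)
        rw [dotProduct_mulVec, ← hR, vecMul_transpose, hRu]
      · simpa using dotProduct_le_smoothNorm (hv i) 1 ((W ∘ Sum.inr) ∘ Sum.inr)
    refine (Real.rpow_le_rpow (expSum_nonneg _ _ _) h1 hα.le).trans_eq ?_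
    rw [Real.mul_rpow (by positivity) (Real.exp_pos _).le, ← Real.exp_mul]
    dsimp only
    rw [← Real.exp_add]
    congr 2
    rw [← hβα]; ring
  have hc1 := (ExpGrowth.exp_smoothNorm l 0 R).1
  have hc2 := (ExpGrowth.exp_smoothNorm l 0 (1 : Matrix ν ν ℝ)).1
  have hint : Integrable (fun V : μ ⊕ ν → ℝ => Real.exp (l * smoothNorm 0 R (V ∘ Sum.inl)) *
        Real.exp (l * smoothNorm 0 (1 : Matrix ν ν ℝ) (V ∘ Sum.inr))) (stdGauss (μ ⊕ ν)) := by
    have := (ExpGrowth.exp_smoothNorm l 0 R).integrable.mul_prod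
      (ExpGrowth.exp_smoothNorm l 0 (1 : Matrix ν ν ℝ)).integrable
    exact (measurePreserving_stdGauss_sum.integrable_comp this.aestronglyMeasurable).2 this
  have hsnd : MeasurePreserving (fun W : ((μ × ν) ⊕ Unit) ⊕ (μ ⊕ ν) → ℝ => W ∘ Sum.inr)
      (stdGauss _) (stdGauss (μ ⊕ ν)) :=
    measurePreserving_snd.comp measurePreserving_stdGauss_sum
  have key2 := integral_mono (ExpGrowth.expSum_rpow β y hα.le hα1).integrable
    (((hsnd.integrable_comp hint.aestronglyMeasurable).2 hint).const_mul
      ((Fintype.card N : ℝ) ^ α)) hy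
  rw [integral_const_mul] at key2
  simp only [Function.comp_def] at key2
  have e1 := integral_comp_inr_stdGauss (ι := (μ × ν) ⊕ Unit)
    (f := fun V : μ ⊕ ν → ℝ => Real.exp (l * smoothNorm 0 R (V ∘ Sum.inl)) *
        Real.exp (l * smoothNorm 0 (1 : Matrix ν ν ℝ) (V ∘ Sum.inr)))
    ((hc1.comp (by fun_prop)).mul (hc2.comp (by fun_prop)))
  simp only [Function.comp_def] at e1
  have e2 := integral_mul_stdGauss_sum hc1 hc2
  simp only [Function.comp_def] at e2
  rw [e1, e2] at key2
  have h1 := integral_exp_norm_proj_le hl hR hRR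
  have h2 := integral_exp_norm_proj_le (ι := ν) hl (R := 1) (by simp) (by simp)
  rw [trace_one] at h2
  have h3 := mul_le_mul h1 h2 (integral_nonneg fun _ => (Real.exp_pos _).le) (Real.exp_pos _).le
  rw [← Real.exp_add] at h3
  -- Each of the two norms costs `exp(l²/2)`; the scalar Gaussian on the left gives one of these
  -- factors back.
  have h4 : (∫ W, expSum β (fun i => tensor (u i) (v i)) W ^ α ∂stdGauss (μ × ν)) *
      Real.exp (l ^ 2 / 2) ≤ ((Fintype.card N : ℝ) ^ α *
        Real.exp (l * (√R.trace + √(Fintype.card ν : ℝ)) + l ^ 2 / 2)) *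
          Real.exp (l ^ 2 / 2) := by
    refine key.trans (key2.trans ((mul_le_mul_of_nonneg_left h3 (by positivity)).trans_eq ?_))
    rw [mul_assoc, ← Real.exp_add]
    congr 2
    ring
  exact le_of_mul_le_mul_right h4 (Real.exp_pos _)

/-- Markov's inequality with `l = T`, followed by `α → 0`, which removes the factor `(card N)^α` and
makes the bound independent of the number of pairs. -/
lemma measureReal_exists_le_tensor_le [Nonempty N] {T : ℝ} (hT : 0 ≤ T)
    {R : Matrix μ μ ℝ} (hR : Rᵀ = R) (hRR : R * R = R) {u : N → μ → ℝ} {v : N → ν → ℝ}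
    (hu : ∀ i, u i ⬝ᵥ u i = 1) (hv : ∀ i, v i ⬝ᵥ v i = 1) (hRu : ∀ i, R *ᵥ u i = u i) :
    (stdGauss (μ × ν)).real {W | ∃ i, √R.trace + √(Fintype.card ν : ℝ) + T ≤
      tensor (u i) (v i) ⬝ᵥ W} ≤ Real.exp (-T ^ 2 / 2) := by
  set c := √R.trace + √(Fintype.card ν : ℝ) with hc
  have key : ∀ α ∈ Set.Ioc (0 : ℝ) 1, (stdGauss (μ × ν)).real {W | ∃ i, c + T ≤
      tensor (u i) (v i) ⬝ᵥ W} ≤ (Fintype.card N : ℝ) ^ α * Real.exp (-T ^ 2 / 2) := by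
    intro α hα
    have h1 := integral_expSum_tensor_le hα.1 hα.2 hT hR hRR hu hv hRu
    have h2 := mul_meas_ge_le_integral_of_nonneg (μ := stdGauss (μ × ν))
      (f := fun W => expSum (T / α) (fun i => tensor (u i) (v i)) W ^ α)
      (Filter.Eventually.of_forall fun W => Real.rpow_nonneg (expSum_nonneg _ _ _) _)
      (ExpGrowth.expSum_rpow _ _ hα.1.le hα.2).integrable (Real.exp (T * (c + T)))
    have h3 : {W | ∃ i, c + T ≤ tensor (u i) (v i) ⬝ᵥ W} ⊆
        {W | Real.exp (T * (c + T)) ≤ expSum (T / α) (fun i => tensor (u i) (v i)) W ^ α} := by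
      rintro W ⟨i, hi⟩
      have h4 := exp_le_expSum (T / α) (fun i => tensor (u i) (v i)) W i
      have h5 := Real.rpow_le_rpow (Real.exp_pos _).le h4 hα.1.le
      refine le_trans ?_ h5
      rw [← Real.exp_mul, Real.exp_le_exp]
      have : T / α * (tensor (u i) (v i) ⬝ᵥ W) * α = T * (tensor (u i) (v i) ⬝ᵥ W) := by
        have := hα.1.ne'
        field_simp
      rw [this]
      exact mul_le_mul_of_nonneg_left hi hT
    refine (measureReal_mono h3).trans ?_
    have h6 := h2.trans h1
    rw [← le_div_iff₀' (Real.exp_pos _)] at h6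
    refine h6.trans_eq ?_
    rw [mul_div_assoc, ← Real.exp_sub]
    congr 2
    ring
  have hlim : Filter.Tendsto (fun α : ℝ => (Fintype.card N : ℝ) ^ α * Real.exp (-T ^ 2 / 2))
      (nhdsWithin 0 (Set.Ioi 0)) (nhds (Real.exp (-T ^ 2 / 2))) := by
    have hN : (Fintype.card N : ℝ) ≠ 0 := by simp
    have : Continuous fun α : ℝ => (Fintype.card N : ℝ) ^ α * Real.exp (-T ^ 2 / 2) :=
      (Real.continuous_const_rpow hN).mul continuous_const
    simpa using (this.tendsto 0).mono_left nhdsWithin_le_nhds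
  refine ge_of_tendsto hlim ?_
  filter_upwards [Ioc_mem_nhdsGT (zero_lt_one (α := ℝ))] with α hα using key α hα

/-- Gaussian tail bound for the norm of the projection of a standard Gaussian matrix. -/
theorem measureReal_exists_lt_tensor_le {T : ℝ} (hT : 0 ≤ T)
    {R : Matrix μ μ ℝ} (hR : Rᵀ = R) (hRR : R * R = R) :
    (stdGauss (μ × ν)).real {W | ∃ (u : μ → ℝ) (v : ν → ℝ), u ⬝ᵥ u = 1 ∧ v ⬝ᵥ v = 1 ∧ R *ᵥ u = u ∧
      √R.trace + √(Fintype.card ν : ℝ) + T < tensor u v ⬝ᵥ W} ≤ Real.exp (-T ^ 2 / 2) := by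
  set c := √R.trace + √(Fintype.card ν : ℝ) + T with hc
  let S := {s : (μ → ℝ) × (ν → ℝ) // s.1 ⬝ᵥ s.1 = 1 ∧ s.2 ⬝ᵥ s.2 = 1 ∧ R *ᵥ s.1 = s.1}
  rcases isEmpty_or_nonempty S with hS | hS
  · have : {W : μ × ν → ℝ | ∃ (u : μ → ℝ) (v : ν → ℝ), u ⬝ᵥ u = 1 ∧ v ⬝ᵥ v = 1 ∧ R *ᵥ u = u ∧
      c < tensor u v ⬝ᵥ W} = ∅ := by
      refine Set.eq_empty_of_forall_notMem ?_
      rintro W ⟨u, v, hu, hv, hRu, -⟩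
      exact hS.false ⟨(u, v), hu, hv, hRu⟩
    rw [this, measureReal_empty]
    exact (Real.exp_pos _).le
  -- The strict inequality is open in `(u, v)`, so a dense sequence detects it; the finite families
  -- increase, and their uniform bound passes to the union.
  let s := TopologicalSpace.denseSeq S
  let B : ℕ → Set (μ × ν → ℝ) := fun k =>
    {W | ∃ i : Fin (k + 1), c ≤ tensor (s i).1.1 (s i).1.2 ⬝ᵥ W}
  have hB : Monotone B := by
    rintro k k' hk W ⟨i, hi⟩
    exact ⟨⟨i, by omega⟩, hi⟩
  have hsub : {W : μ × ν → ℝ | ∃ (u : μ → ℝ) (v : ν → ℝ), u ⬝ᵥ u = 1 ∧ v ⬝ᵥ v = 1 ∧ R *ᵥ u = u ∧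
      c < tensor u v ⬝ᵥ W} ⊆ ⋃ k, B k := by
    rintro W ⟨u, v, hu, hv, hRu, hW⟩
    have hcont : Continuous fun q : S => tensor q.1.1 q.1.2 ⬝ᵥ W := by
      unfold tensor dotProduct
      fun_prop
    obtain ⟨k, hk⟩ := (TopologicalSpace.denseRange_denseSeq S).exists_mem_open
      (isOpen_lt continuous_const hcont) ⟨⟨(u, v), hu, hv, hRu⟩, hW⟩
    exact Set.mem_iUnion.2 ⟨k, ⟨k, by omega⟩, le_of_lt hk⟩
  have hbound : ∀ k, stdGauss (μ × ν) (B k) ≤ ENNReal.ofReal (Real.exp (-T ^ 2 / 2)) := by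
    intro k
    rw [← ENNReal.ofReal_toReal (measure_ne_top (stdGauss (μ × ν)) (B k))]
    refine ENNReal.ofReal_le_ofReal (measureReal_exists_le_tensor_le hT hR hRR
      (u := fun i : Fin (k + 1) => (s i).1.1) (v := fun i => (s i).1.2)
      (fun i => (s i).2.1) (fun i => (s i).2.2.1) fun i => (s i).2.2.2)
  refine ENNReal.toReal_le_of_le_ofReal (Real.exp_pos _).le ((measure_mono hsub).trans ?_)
  rw [hB.measure_iUnion]
  exact iSup_le hbound

end TailBound

end NNP

/-! ### From the bilinear tail bound to the noise event. -/

namespace NNP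

open Matrix

lemma map_gaussianNoise {m n : ℕ} {Ω : Type*} [MeasurableSpace Ω] {P : Measure Ω}
    [IsProbabilityMeasure P] {σ : ℝ≥0} {E : Ω → Matrix (Fin m) (Fin n) ℝ}
    (hE : IsGaussianNoise P σ E) :
    P.map (fun ω (q : Fin m × Fin n) => E ω q.1 q.2) =
      (stdGauss (Fin m × Fin n)).map fun W q => (σ : ℝ) * W q := by
  rw [(iIndepFun_iff_map_fun_eq_pi_map fun q : Fin m × Fin n =>
    (hE.1 q.1 q.2).aemeasurable).1 hE.2, stdGauss,
    Measure.pi_map_pi (f := fun _ x => (σ : ℝ) * x) fun _ => by fun_prop]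
  congr 1
  funext q
  rw [(hE.1 q.1 q.2).map_eq, gaussianReal_map_const_mul, mul_zero, mul_one]
  congr 1

lemma toEuclideanLin_tensor_inner {m n : ℕ} (E : Matrix (Fin m) (Fin n) ℝ)
    (x : EuclideanSpace ℝ (Fin n)) (y : EuclideanSpace ℝ (Fin m)) :
    inner ℝ y (toEuclideanLin E x) =
      tensor (WithLp.ofLp y) (WithLp.ofLp x) ⬝ᵥ fun q => E q.1 q.2 := by
  simp only [PiLp.inner_apply, tensor, dotProduct, Fintype.sum_prod_type, toLpLin_apply, mulVec,
    RCLike.inner_apply, conj_trivial, Finset.sum_mul]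
  exact Finset.sum_congr rfl fun i _ => Finset.sum_congr rfl fun j _ => by ring

lemma dotProduct_self_eq_norm_sq {m : ℕ} (y : EuclideanSpace ℝ (Fin m)) :
    WithLp.ofLp y ⬝ᵥ WithLp.ofLp y = ‖y‖ ^ 2 := by
  rw [EuclideanSpace.norm_sq_eq]
  simp [dotProduct, sq]

/-- If the bilinear form of `E` is bounded on unit vectors of the column space of `X` then the
operator norm of `Xᵀ E` is bounded. -/
lemma norm_transpose_mul_apply_le {m n p : ℕ} {X : Matrix (Fin m) (Fin p) ℝ}
    {E : Matrix (Fin m) (Fin n) ℝ} {R : Matrix (Fin m) (Fin m) ℝ} (hRX : R * X = X) {c : ℝ}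
    (hc : 0 ≤ c)
    (h : ∀ (u : Fin m → ℝ) (v : Fin n → ℝ), u ⬝ᵥ u = 1 → v ⬝ᵥ v = 1 → R *ᵥ u = u →
      (tensor u v ⬝ᵥ fun q => E q.1 q.2) ≤ c) (x : EuclideanSpace ℝ (Fin n)) :
    ‖toEuclideanLin (Xᵀ * E) x‖ ≤ sv X 1 * c * ‖x‖ := by
  set y := toEuclideanLin (Xᵀ * E) x with hy
  have hs := sv_nonneg X 1
  have h1 : ‖y‖ ^ 2 = inner ℝ (toEuclideanLin X y) (toEuclideanLin E x) := by
    rw [inner_toEuclideanLin_left, ← toEuclideanLin_mul, ← hy, real_inner_self_eq_norm_sq]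
  set z := toEuclideanLin X y with hz
  have h2 : inner ℝ z (toEuclideanLin E x) ≤ ‖z‖ * ‖x‖ * c := by
    rcases eq_or_ne z 0 with h0 | hz0
    · simp [h0]
    rcases eq_or_ne x 0 with h0 | hx0
    · simp [h0]
    have hzn := norm_ne_zero_iff.2 hz0
    have hxn := norm_ne_zero_iff.2 hx0
    have h3 := h (WithLp.ofLp (‖z‖⁻¹ • z)) (WithLp.ofLp (‖x‖⁻¹ • x))
      (by rw [dotProduct_self_eq_norm_sq, norm_smul, norm_inv, norm_norm]; field_simp)
      (by rw [dotProduct_self_eq_norm_sq, norm_smul, norm_inv, norm_norm]; field_simp)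
      (by simp [mulVec_smul, hz, toLpLin_apply, hRX])
    rw [← toEuclideanLin_tensor_inner, map_smul, inner_smul_left, inner_smul_right] at h3
    have h4 : inner ℝ z (toEuclideanLin E x) =
        ‖z‖ * ‖x‖ * ((starRingEnd ℝ) ‖z‖⁻¹ * (‖x‖⁻¹ * inner ℝ z (toEuclideanLin E x))) := by
      simp only [conj_trivial]
      field_simp
    rw [h4]
    exact mul_le_mul_of_nonneg_left h3 (by positivity)
  have h5 : ‖z‖ ≤ sv X 1 * ‖y‖ :=
    le_of_sq_le_sq (by rw [mul_pow]; exact norm_sq_apply_le X y) (by positivity)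
  rcases (norm_nonneg y).eq_or_lt with h0 | hy0
  · rw [← h0]; positivity
  · have h6 := mul_le_mul_of_nonneg_right h5 (mul_nonneg (norm_nonneg x) hc)
    refine le_of_mul_le_mul_right ?_ hy0
    rw [← sq, h1]
    linarith

/-- The orthogonal projection on the column space of a matrix of full column rank. -/
lemma exists_column_projection {m p : ℕ} {X : Matrix (Fin m) (Fin p) ℝ} (hX : 0 < sv X p) :
    ∃ R : Matrix (Fin m) (Fin m) ℝ, Rᵀ = R ∧ R * R = R ∧ R * X = X ∧ R.trace = p := by
  have hinj : Function.Injective (Xᵀ * X).mulVec := by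
    refine (injective_iff_map_eq_zero (Xᵀ * X).mulVecLin).2 fun w hw => ?_
    have h1 : X *ᵥ w = 0 := by
      rw [mulVecLin_apply, ← mulVec_mulVec] at hw
      have : (X *ᵥ w) ⬝ᵥ (X *ᵥ w) = 0 := by
        rw [dotProduct_mulVec, ← mulVec_transpose, hw, zero_dotProduct]
      exact dotProduct_self_eq_zero.1 this
    have h2 := le_norm_sq_apply X (WithLp.toLp 2 w)
    have h3 : toEuclideanLin X (WithLp.toLp 2 w) = 0 := by simp [toLpLin_apply, h1]
    rw [h3, norm_zero] at h2
    have h4 : ‖WithLp.toLp 2 w‖ ^ 2 = 0 := by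
      have : 0 < sv X p ^ 2 := by positivity
      nlinarith [sq_nonneg ‖WithLp.toLp 2 w‖]
    simpa using h4
  have hu : IsUnit (Xᵀ * X) := mulVec_injective_iff_isUnit.1 hinj
  have hdet := (isUnit_iff_isUnit_det _).1 hu
  have hsym : (Xᵀ * X)ᵀ = Xᵀ * X := by rw [transpose_mul, transpose_transpose]
  have hX1 : X * (Xᵀ * X)⁻¹ * Xᵀ * X = X := by
    rw [Matrix.mul_assoc, Matrix.mul_assoc, nonsing_inv_mul _ hdet, Matrix.mul_one]
  refine ⟨X * (Xᵀ * X)⁻¹ * Xᵀ, ?_, ?_, hX1, ?_⟩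
  · rw [transpose_mul, transpose_mul, transpose_transpose, transpose_nonsing_inv, hsym,
      Matrix.mul_assoc]
  · rw [← Matrix.mul_assoc, ← Matrix.mul_assoc, hX1]
  · rw [trace_mul_comm, ← Matrix.mul_assoc, mul_nonsing_inv _ hdet, trace_one, Fintype.card_fin]

/-- With high probability the noise satisfies the operator norm bound that the choice of the
penalty level requires. -/
lemma measureReal_noise_bound {m n p : ℕ} {X : Matrix (Fin m) (Fin p) ℝ} (hX : 0 < sv X p)
    {Ω : Type*} [MeasurableSpace Ω] {P : Measure Ω} [IsProbabilityMeasure P] {σ : ℝ≥0}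
    {E : Ω → Matrix (Fin m) (Fin n) ℝ} (hE : IsGaussianNoise P σ E) {θ : ℝ} (hθ : 0 < θ) :
    1 - Real.exp (-(θ ^ 2 * ((n : ℝ) + p) / 2)) ≤
      P.real {ω | ∀ x, ‖toEuclideanLin (Xᵀ * E ω) x‖ ≤
        (1 + θ) * sv X 1 * σ * (√(n : ℝ) + √(p : ℝ)) * ‖x‖} := by
  obtain ⟨R, hR, hRR, hRX, htr⟩ := exists_column_projection hX
  set T := θ * (√(n : ℝ) + √(p : ℝ)) with hT
  have hT0 : 0 ≤ T := by positivity
  set c := √R.trace + √(Fintype.card (Fin n) : ℝ) + T with hc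
  have hc' : c = (1 + θ) * (√(n : ℝ) + √(p : ℝ)) := by
    rw [hc, htr, Fintype.card_fin, hT]; ring
  let bad : Set (Fin m × Fin n → ℝ) := {V | ∃ (u : Fin m → ℝ) (v : Fin n → ℝ),
    u ⬝ᵥ u = 1 ∧ v ⬝ᵥ v = 1 ∧ R *ᵥ u = u ∧ σ * c < tensor u v ⬝ᵥ V}
  have hopen : IsOpen bad := by
    have : bad = ⋃ (u : Fin m → ℝ) (v : Fin n → ℝ)
        (_ : u ⬝ᵥ u = 1 ∧ v ⬝ᵥ v = 1 ∧ R *ᵥ u = u), {V | σ * c < tensor u v ⬝ᵥ V} := by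
      ext V
      simp only [bad, Set.mem_iUnion, Set.mem_ofPred_eq, exists_prop, and_assoc]
    rw [this]
    refine isOpen_iUnion fun u => isOpen_iUnion fun v => isOpen_iUnion fun _ => ?_
    refine isOpen_lt continuous_const ?_
    unfold dotProduct
    fun_prop
  have hmeas : AEMeasurable (fun ω (q : Fin m × Fin n) => E ω q.1 q.2) P :=
    aemeasurable_pi_lambda _ fun q => (hE.1 q.1 q.2).aemeasurable
  have hprob : P.real ((fun ω (q : Fin m × Fin n) => E ω q.1 q.2) ⁻¹' bad) ≤
      Real.exp (-(θ ^ 2 * ((n : ℝ) + p) / 2)) := by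
    rw [← map_measureReal_apply_of_aemeasurable hmeas hopen.measurableSet, map_gaussianNoise hE,
      map_measureReal_apply (by fun_prop) hopen.measurableSet]
    refine (measureReal_mono ?_).trans
      ((measureReal_exists_lt_tensor_le (ν := Fin n) hT0 hR hRR).trans ?_)
    · rintro W ⟨u, v, hu, hv, hRu, hW⟩
      refine ⟨u, v, hu, hv, hRu, lt_of_mul_lt_mul_left ?_ σ.coe_nonneg⟩
      refine hW.trans_eq ?_
      simp only [dotProduct, Finset.mul_sum]
      exact Finset.sum_congr rfl fun q _ => by ring
    · rw [Real.exp_le_exp, neg_div, neg_le_neg_iff, hT, mul_pow]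
      have h1 : (√(n : ℝ) + √(p : ℝ)) ^ 2 = n + p + 2 * (√(n : ℝ) * √(p : ℝ)) := by
        rw [add_sq, Real.sq_sqrt (by positivity), Real.sq_sqrt (by positivity)]; ring
      rw [h1]
      have h2 : 0 ≤ θ ^ 2 * (√(n : ℝ) * √(p : ℝ)) := by positivity
      linarith
  have hsub : Set.univ ⊆ {ω | ∀ x, ‖toEuclideanLin (Xᵀ * E ω) x‖ ≤
        (1 + θ) * sv X 1 * σ * (√(n : ℝ) + √(p : ℝ)) * ‖x‖} ∪
      (fun ω (q : Fin m × Fin n) => E ω q.1 q.2) ⁻¹' bad := by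
    intro ω _
    by_cases hω : (fun q : Fin m × Fin n => E ω q.1 q.2) ∈ bad
    · exact Or.inr hω
    · refine Or.inl fun x => ?_
      have h1 := norm_transpose_mul_apply_le hRX (c := σ * c) (by positivity)
        (fun u v hu hv hRu => not_lt.1 fun hlt => hω ⟨u, v, hu, hv, hRu, hlt⟩) x
      refine h1.trans_eq ?_
      rw [hc']
      ring
  have h2 := (measureReal_mono hsub).trans (measureReal_union_le (μ := P) _ _)
  rw [probReal_univ] at h2
  linarith

end NNP

open NNP

theorem theorem12 (θ : ℝ) (hθ : 0 < θ) :
    ∃ C : ℝ, 0 < C ∧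
      ∀ (m n p : ℕ) (X : Matrix (Fin m) (Fin p) ℝ) (A : Matrix (Fin p) (Fin n) ℝ) (σ : ℝ≥0)
        (_hX : 0 < NNP.eig (Xᵀ * X) p)
        (Ω : Type*) (_ : MeasurableSpace Ω) (P : Measure Ω) (_ : IsProbabilityMeasure P)
        (E : Ω → Matrix (Fin m) (Fin n) ℝ) (_hE : NNP.IsGaussianNoise P σ E)
        (τ : ℝ) (_hτ : τ = (1 + θ) * NNP.sv X 1 * σ * (√(n : ℝ) + √(X.rank : ℝ)))
        (Ahat : Ω → Matrix (Fin p) (Fin n) ℝ)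
        (_hAhat : ∀ ω, NNP.IsNNPEstimator X (X * A + E ω) τ (Ahat ω)),
        1 - Real.exp (-(θ ^ 2 * ((n : ℝ) + X.rank) / 2)) ≤
          P.real {ω |
            NNP.frobSq (X * Ahat ω - X * A) ≤
              C * (Finset.range (A.rank + 1)).inf' Finset.nonempty_range_add_one (fun k : ℕ =>
                (∑ j ∈ Finset.Icc (k + 1) A.rank, NNP.sv (X * A) j ^ 2) +
                  NNP.condNumber (Xᵀ * X) * k * (σ : ℝ) ^ 2 * ((n : ℝ) + X.rank)) ∧
            ∀ k ≤ A.rank,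
              NNP.frobSq (Ahat ω - A) ≤
                C * (NNP.condNumber (Xᵀ * X) * ∑ j ∈ Finset.Icc (k + 1) A.rank, NNP.sv A j ^ 2 +
                  NNP.condNumber (Xᵀ * X) / NNP.eig (Xᵀ * X) p * k *
                    (σ : ℝ) ^ 2 * ((n : ℝ) + X.rank))} := by
  refine ⟨4 + 108 * (1 + θ) ^ 2, by positivity, ?_⟩
  intro m n p X A σ hX Ω _ P _ E hE τ hτ Ahat hAhat
  have hp : 1 ≤ p := by
    by_contra! h
    have h1 : eig (Xᵀ * X) p = 0 := dif_neg fun h' => by omega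
    exact hX.ne' h1
  have e1 : eig (Xᵀ * X) 1 = sv X 1 ^ 2 := eig_transpose_mul_self X le_rfl hp
  have ep : eig (Xᵀ * X) p = sv X p ^ 2 := eig_transpose_mul_self X hp le_rfl
  have hs : 0 < sv X p :=
    (sv_nonneg X p).lt_of_ne fun h => by rw [ep, ← h] at hX; simp at hX
  have hrank : X.rank = p := by
    refine le_antisymm X.rank_le_width ?_
    by_contra! hlt
    obtain ⟨i, rfl⟩ : ∃ i, p = i + 1 := ⟨p - 1, by omega⟩
    exact hs.ne' (sv_eq_zero_iff.2 (by omega))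
  rw [condNumber, e1, ep]
  rw [hrank] at hτ ⊢
  set s₁ := sv X 1 with hs₁
  set s := sv X p with hs_def
  have hs1 : 0 ≤ s₁ := sv_nonneg X 1
  have hτ0 : 0 ≤ τ := by rw [hτ]; positivity
  have hτ2 : τ ^ 2 ≤ 2 * (1 + θ) ^ 2 * s₁ ^ 2 * (σ : ℝ) ^ 2 * (n + p) := by
    have h1 : (√(n : ℝ) + √(p : ℝ)) ^ 2 ≤ 2 * (n + p) := by
      have := add_sq_le (a := √(n : ℝ)) (b := √(p : ℝ))
      rwa [Real.sq_sqrt (by positivity), Real.sq_sqrt (by positivity)] at this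
    have h2 := mul_le_mul_of_nonneg_left h1
      (by positivity : 0 ≤ (1 + θ) ^ 2 * s₁ ^ 2 * (σ : ℝ) ^ 2)
    rw [hτ]
    linarith
  have horacle : ∀ ω, (∀ x, ‖Matrix.toEuclideanLin (Xᵀ * E ω) x‖ ≤ τ * ‖x‖) →
      ∀ (k : ℕ) (B : Matrix (Fin p) (Fin n) ℝ), B.rank ≤ k →
        frobSq (X * Ahat ω - X * A) ≤ (4 + 108 * (1 + θ) ^ 2) * (frobSq (X * B - X * A) +
          s₁ ^ 2 / s ^ 2 * k * (σ : ℝ) ^ 2 * (n + p)) := by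
    intro ω hω k B hB
    refine ((hAhat ω).prediction_error_le hτ0 hs hω hB).trans ?_
    have h1 : τ ^ 2 * k / s ^ 2 ≤
        2 * (1 + θ) ^ 2 * (s₁ ^ 2 / s ^ 2 * k * (σ : ℝ) ^ 2 * (n + p)) := by
      have h2 := mul_le_mul_of_nonneg_right hτ2 (by positivity : 0 ≤ (k : ℝ) / s ^ 2)
      calc _ = τ ^ 2 * (k / s ^ 2) := by ring
        _ ≤ _ := h2
        _ = _ := by ring
    have h3 : 0 ≤ s₁ ^ 2 / s ^ 2 * k * (σ : ℝ) ^ 2 * (n + p) := by positivity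
    have h4 := mul_nonneg (by positivity : 0 ≤ 108 * (1 + θ) ^ 2) (frobSq_nonneg (X * B - X * A))
    linarith
  refine (measureReal_noise_bound hs hE hθ).trans (measureReal_mono fun ω hω => ?_)
  rw [Set.mem_ofPred_eq, ← hs₁, ← hτ] at hω
  refine ⟨?_, fun k _ => ?_⟩
  · obtain ⟨k, -, hk⟩ := Finset.exists_mem_eq_inf' (Finset.nonempty_range_add_one (n := A.rank))
      (fun k : ℕ => (∑ j ∈ Finset.Icc (k + 1) A.rank, sv (X * A) j ^ 2) +
        s₁ ^ 2 / s ^ 2 * k * (σ : ℝ) ^ 2 * ((n : ℝ) + p))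
    rw [hk]
    obtain ⟨Q, hQ, hQA⟩ := exists_truncation (X * A) (k := k) (Matrix.rank_mul_le_right X A)
    rw [Matrix.mul_assoc] at hQA
    refine (horacle ω hω k (A * Q) ((Matrix.rank_mul_le_right A Q).trans hQ)).trans ?_
    gcongr
  · obtain ⟨Q, hQ, hQA⟩ := exists_truncation A (k := k) le_rfl
    have h1 := horacle ω hω k (A * Q) ((Matrix.rank_mul_le_right A Q).trans hQ)
    have h2 := frobSq_mul_le X (A * Q - A)
    have h3 := le_frobSq_mul X (Ahat ω - A)
    rw [Matrix.mul_sub] at h2 h3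
    have h4 : s ^ 2 * frobSq (Ahat ω - A) ≤ (4 + 108 * (1 + θ) ^ 2) *
        (s₁ ^ 2 * (∑ j ∈ Finset.Icc (k + 1) A.rank, sv A j ^ 2) +
          s₁ ^ 2 / s ^ 2 * k * (σ : ℝ) ^ 2 * (n + p)) := by
      refine h3.trans (h1.trans ?_)
      gcongr
      exact h2.trans (mul_le_mul_of_nonneg_left hQA (sq_nonneg _))
    rw [← le_div_iff₀' (by positivity)] at h4
    refine h4.trans_eq ?_
    field_simp
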